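/- Let $\Gamma$ be a cancellation monoid, i.e. a (not necessarily commutative) monoid satisfying the left and right cancellation laws, and let $R=\bigoplus_{\alpha\in\Gamma}R_\alpha$ be a $\Gamma$-graded (associative, unital, not necessarily commutative) ring, so that $R_\alpha R_\beta\subseteq R_{\alpha\beta}$ for all $\alpha,\beta\in\Gamma$. A $\Gamma$-graded left (resp. right) $R$-module is a left (resp. right) $R$-module $M$ with a direct sum decomposition $M=\bigoplus_{\alpha\in\Gamma}M_\alpha$ into additive subgroups such that $R_\alpha M_\beta\subseteq M_{\alpha\beta}$ (resp. $M_\alpha R_\beta\subseteq M_{\alpha\beta}$) for all $\alpha,\beta\in\Gamma$. For a left (resp. right) $R$-module $M$, let $\operatorname{fd}_R(M)\in\{0,1,2,\dots\}\cup\{\infty\}$ be its usual flat dimension: the least $n\ge 0$ for which there is an exact sequence $$0\to F_n\to\cdots\to F_1\to F_0\to M\to 0$$ with all $F_i$ flat left (resp. right) $R$-modules, and $\infty$ if there is no such $n$. Define $$\text{gr-}\ell\mathrm{wD}(R):=\sup\{\operatorname{fd}_R(M)\mid M\text{ is a }\Gamma\text{-graded left }R\text{-module}\},$$ $$\text{gr-}r\mathrm{wD}(R):=\sup\{\operatorname{fd}_R(M)\mid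 M\text{ is a }\Gamma\text{-graded right }R\text{-module}\}.$$ Then $$\text{gr-}\ell\mathrm{wD}(R)=\text{gr-}r\mathrm{wD}(R).$$ -/

import Mathlib

open scoped TensorProduct DirectSum

universe u v w

/-!
Throughout, a right `R`-module is, as everywhere in Mathlib, a module over `Rᵐᵒᵖ`; the right
action of `r` on `x` is `MulOpposite.op r • x`.
-/

section Tensor

variable (R : Type u) [Ring R]

/-- The subgroup of `N ⊗[ℤ] F` generated by all `(n r) ⊗ x - n ⊗ (r x)`. -/
def balancedRelations (N : Type v) [AddCommGroup N] [Module Rᵐᵒᵖ N]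
    (F : Type w) [AddCommGroup F] [Module R F] : AddSubgroup (N ⊗[ℤ] F) :=
  AddSubgroup.closure
    {t | ∃ (n : N) (r : R) (x : F), t = (MulOpposite.op r • n) ⊗ₜ[ℤ] x - n ⊗ₜ[ℤ] (r • x)}

/-- The tensor product `N ⊗_R F` of a right `R`-module `N` and a left `R`-module `F` over a
not necessarily commutative ring `R`; it is an abelian group. -/
abbrev BalancedTensor (N : Type v) [AddCommGroup N] [Module Rᵐᵒᵖ N]
    (F : Type w) [AddCommGroup F] [Module R F] : Type (max v w) :=
  (N ⊗[ℤ] F) ⧸ balancedRelations R N F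

/-- The homomorphism `f ⊗_R g : N ⊗_R F → N' ⊗_R F'`, `n ⊗ x ↦ f n ⊗ g x`. -/
def BalancedTensor.map {N N' : Type v} [AddCommGroup N] [Module Rᵐᵒᵖ N]
    [AddCommGroup N'] [Module Rᵐᵒᵖ N']
    {F F' : Type w} [AddCommGroup F] [Module R F] [AddCommGroup F'] [Module R F']
    (f : N →ₗ[Rᵐᵒᵖ] N') (g : F →ₗ[R] F') : BalancedTensor R N F →+ BalancedTensor R N' F' :=
  QuotientAddGroup.map (balancedRelations R N F) (balancedRelations R N' F')
    (TensorProduct.map f.toAddMonoidHom.toIntLinearMap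
      g.toAddMonoidHom.toIntLinearMap).toAddMonoidHom
    (by
      refine (AddSubgroup.closure_le _).2 ?_
      rintro _ ⟨n, r, x, rfl⟩
      refine AddSubgroup.subset_closure ⟨f n, r, g x, ?_⟩
      simp)

/-- A left `R`-module `F` is flat if `- ⊗_R F` preserves injectivity of homomorphisms of right
`R`-modules. -/
def IsFlatLeft (F : Type v) [AddCommGroup F] [Module R F] : Prop :=
  ∀ (N N' : Type (max u v)) [AddCommGroup N] [Module Rᵐᵒᵖ N] [AddCommGroup N'] [Module Rᵐᵒᵖ N']
    (f : N →ₗ[Rᵐᵒᵖ] N'), Function.Injective f →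
      Function.Injective (BalancedTensor.map R f (LinearMap.id : F →ₗ[R] F))

/-- A right `R`-module `F` is flat if `F ⊗_R -` preserves injectivity of homomorphisms of left
`R`-modules. -/
def IsFlatRight (F : Type v) [AddCommGroup F] [Module Rᵐᵒᵖ F] : Prop :=
  ∀ (N N' : Type (max u v)) [AddCommGroup N] [Module R N] [AddCommGroup N'] [Module R N']
    (g : N →ₗ[R] N'), Function.Injective g →
      Function.Injective (BalancedTensor.map R (LinearMap.id : F →ₗ[Rᵐᵒᵖ] F) g)

end Tensor

section FlatDimension

/-- An exact sequence `⋯ → X 2 → X 1 → X 0 → M → 0` of `S`-modules. -/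
structure LeftResolution (S : Type u) [Ring S] (M : Type v) [AddCommGroup M] [Module S M] where
  X : ℕ → Type (max u v)
  [addCommGroup : ∀ i, AddCommGroup (X i)]
  [module : ∀ i, Module S (X i)]
  d : ∀ i, X (i + 1) →ₗ[S] X i
  aug : X 0 →ₗ[S] M
  aug_surjective : Function.Surjective aug
  exact_zero : Function.Exact (d 0) aug
  exact_succ : ∀ i, Function.Exact (d (i + 1)) (d i)

attribute [instance] LeftResolution.addCommGroup LeftResolution.module

/-- The flat dimension of a left `R`-module `M`: the least `n` such that there is an exact
sequence `0 → X n → ⋯ → X 0 → M → 0` with all `X i` flat, and `⊤` if there is no such `n`. -/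
noncomputable def leftFlatDim (R : Type u) [Ring R] (M : Type v) [AddCommGroup M] [Module R M] :
    ℕ∞ :=
  sInf {d | ∃ n : ℕ, d = (n : ℕ∞) ∧ ∃ P : LeftResolution R M,
    (∀ i, IsFlatLeft R (P.X i)) ∧ ∀ i, n < i → Subsingleton (P.X i)}

/-- The flat dimension of a right `R`-module `M`. -/
noncomputable def rightFlatDim (R : Type u) [Ring R] (M : Type v) [AddCommGroup M]
    [Module Rᵐᵒᵖ M] : ℕ∞ :=
  sInf {d | ∃ n : ℕ, d = (n : ℕ∞) ∧ ∃ P : LeftResolution Rᵐᵒᵖ M,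
    (∀ i, IsFlatRight R (P.X i)) ∧ ∀ i, n < i → Subsingleton (P.X i)}

end FlatDimension

section Graded

variable {Γ : Type v} [DecidableEq Γ] [AddMonoid Γ] {R : Type u} [Ring R]

/-- `ℳ` makes the left `R`-module `M` a `Γ`-graded left `R`-module: `M` is the direct sum of
the subgroups `ℳ α`, and `R_α M_β ⊆ M_{α + β}`. -/
structure IsGradedLeftModule (𝒜 : Γ → AddSubgroup R) {M : Type w} [AddCommGroup M] [Module R M]
    (ℳ : Γ → AddSubgroup M) : Prop where
  isInternal : DirectSum.IsInternal ℳ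
  smul_mem : ∀ (α β : Γ) (a : R) (x : M), a ∈ 𝒜 α → x ∈ ℳ β → a • x ∈ ℳ (α + β)

/-- `ℳ` makes the right `R`-module `M` a `Γ`-graded right `R`-module: `M` is the direct sum of
the subgroups `ℳ α`, and `M_α R_β ⊆ M_{α + β}`. -/
structure IsGradedRightModule (𝒜 : Γ → AddSubgroup R) {M : Type w} [AddCommGroup M]
    [Module Rᵐᵒᵖ M] (ℳ : Γ → AddSubgroup M) : Prop where
  isInternal : DirectSum.IsInternal ℳ
  smul_mem : ∀ (α β : Γ) (x : M) (a : R), x ∈ ℳ α → a ∈ 𝒜 β →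
    MulOpposite.op a • x ∈ ℳ (α + β)

/-- The graded left weak dimension: the supremum of the flat dimensions of all `Γ`-graded left
`R`-modules (in an arbitrary universe at least as large as that of `R`). -/
noncomputable def grLeftWeakDim (𝒜 : Γ → AddSubgroup R) : ℕ∞ :=
  sSup {d | ∃ (M : Type (max u w)) (_ : AddCommGroup M) (_ : Module R M) (ℳ : Γ → AddSubgroup M),
    IsGradedLeftModule 𝒜 ℳ ∧ d = leftFlatDim R M}

/-- The graded right weak dimension: the supremum of the flat dimensions of all `Γ`-graded right
`R`-modules (in an arbitrary universe at least as large as that of `R`). -/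
noncomputable def grRightWeakDim (𝒜 : Γ → AddSubgroup R) : ℕ∞ :=
  sSup {d | ∃ (M : Type (max u w)) (_ : AddCommGroup M) (_ : Module Rᵐᵒᵖ M)
    (ℳ : Γ → AddSubgroup M), IsGradedRightModule 𝒜 ℳ ∧ d = rightFlatDim R M}

end Graded

-- If every graded right module N has flat dimension at most n, then Tor_{n+1}(N, M) = 0 for all
-- left modules M. For graded M, resolving by graded free modules leaves a graded n-th syzygy K with
-- Tor_1(N, K) = 0 for all graded N. The point is that such a K is flat, although vanishing is known
-- only against graded N (`IsLeftGrading.flatLeft`). The other inequality is the same statement for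
-- the opposite ring and monoid; hence the setting of rings A and B with A ≅ Bᵐᵒᵖ.
--
-- Let q : F → K be a graded free cover, with basis ε_i over homogeneous y_i, and let c = Σ c_i ε_i
-- in ker q be homogeneous. The right ideal J generated by the c_i is graded, so Tor_1(A/J, K) = 0
-- makes J ⊗ K → K injective and Σ c_i ⊗ y_i = 0 in J ⊗ K. Right exactness turns this into lifts e_i
-- of y_i to F with Σ c_i e_i = 0. Homogeneous components of the e_i give a graded endomorphism φ of
-- F with qφ = q and φ(c) = 0 (`IsLeftGrading.exists_endomorphism`). Composing such φ kills any
-- given element of N' ⊗ ker q, and flatness of K follows from that of F.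
--
-- Right cancellation grades free modules on generators of arbitrary degrees; left cancellation
-- makes homogeneous scalars commute with taking components. Tor itself is not constructed: its
-- vanishing is the injectivity statement `TorVanish`, and its balance is a pair of diagram chases.

universe v₁ v₂ v₃

/-! ### Tensor products over a ring and its opposite -/

section AntiTensor

variable {A B : Type u} [Ring A] [Ring B] (σ : A ≃+* Bᵐᵒᵖ)

/-- The relations defining the tensor product of a `B`-module and an `A`-module, where `B` is
identified with the opposite ring of `A`. -/
def antiRelations (N : Type v₁) [AddCommGroup N] [Module B N]
    (F : Type v₂) [AddCommGroup F] [Module A F] : AddSubgroup (N ⊗[ℤ] F) :=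
  AddSubgroup.closure
    {t | ∃ (n : N) (a : A) (x : F), t = ((σ a).unop • n) ⊗ₜ[ℤ] x - n ⊗ₜ[ℤ] (a • x)}

/-- The tensor product of a `B`-module and an `A`-module, where `B` is identified with the
opposite ring of `A`. -/
abbrev AntiTensor (N : Type v₁) [AddCommGroup N] [Module B N]
    (F : Type v₂) [AddCommGroup F] [Module A F] : Type (max v₁ v₂) :=
  (N ⊗[ℤ] F) ⧸ antiRelations σ N F

namespace AntiTensor

variable {N N' N'' : Type v₁} [AddCommGroup N] [Module B N] [AddCommGroup N'] [Module B N']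
  [AddCommGroup N''] [Module B N'']
  {F F' F'' : Type v₂} [AddCommGroup F] [Module A F] [AddCommGroup F'] [Module A F']
  [AddCommGroup F''] [Module A F'']
  {G : Type v₃} [AddCommGroup G]

/-- The class of a pure tensor. -/
def tmul (n : N) (x : F) : AntiTensor σ N F := QuotientAddGroup.mk (n ⊗ₜ[ℤ] x)

theorem tmul_add (n : N) (x y : F) : tmul σ n (x + y) = tmul σ n x + tmul σ n y := by
  simp [tmul, TensorProduct.tmul_add]

theorem add_tmul (n m : N) (x : F) : tmul σ (n + m) x = tmul σ n x + tmul σ m x := by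
  simp [tmul, TensorProduct.add_tmul]

theorem tmul_zero (n : N) : tmul σ n (0 : F) = 0 := by
  simp [tmul]

theorem zero_tmul (x : F) : tmul σ (0 : N) x = 0 := by
  simp [tmul]

theorem smul_tmul (n : N) (a : A) (x : F) :
    tmul σ ((σ a).unop • n) x = tmul σ n (a • x) := by
  refine (QuotientAddGroup.eq_iff_sub_mem).2 ?_
  exact AddSubgroup.subset_closure ⟨n, a, x, rfl⟩

@[elab_as_elim]
theorem induction_on {p : AntiTensor σ N F → Prop} (t : AntiTensor σ N F) (zero : p 0)
    (tmul : ∀ n x, p (tmul σ n x)) (add : ∀ s t, p s → p t → p (s + t)) : p t := by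
  induction t using QuotientAddGroup.induction_on with
  | H z =>
    induction z using TensorProduct.induction_on with
    | zero => exact zero
    | tmul n x => exact tmul n x
    | add s t hs ht => exact add _ _ hs ht

/-- The homomorphism out of the tensor product induced by a balanced biadditive map. -/
def lift (f : N →+ F →+ G) (h : ∀ n a x, f ((σ a).unop • n) x = f n (a • x)) :
    AntiTensor σ N F →+ G :=
  QuotientAddGroup.lift (antiRelations σ N F)
    (TensorProduct.liftAddHom f (fun r n x => by simp)) (by
      refine (AddSubgroup.closure_le _).2 ?_
      rintro _ ⟨n, a, x, rfl⟩
      simp [h])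

@[simp]
theorem lift_tmul (f : N →+ F →+ G) (h : ∀ n a x, f ((σ a).unop • n) x = f n (a • x))
    (n : N) (x : F) : lift σ f h (tmul σ n x) = f n x := rfl

variable {σ} in
theorem hom_ext {f g : AntiTensor σ N F →+ G} (h : ∀ n x, f (tmul σ n x) = g (tmul σ n x)) :
    f = g := by
  refine DFunLike.ext _ _ fun t => ?_
  induction t using induction_on with
  | zero => simp
  | tmul n x => exact h n x
  | add s t hs ht => simpa using congrArg₂ (· + ·) hs ht

/-- The pure tensors as a biadditive map. -/
def tmulHom : N →+ F →+ AntiTensor σ N F :=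
  AddMonoidHom.mk' (fun n => AddMonoidHom.mk' (tmul σ n) (tmul_add σ n))
    (fun n m => by ext x; exact add_tmul σ n m x)

@[simp]
theorem tmulHom_apply (n : N) (x : F) : tmulHom σ n x = tmul σ n x := rfl

/-- Functoriality of the tensor product. -/
def map (f : N →ₗ[B] N') (g : F →ₗ[A] F') : AntiTensor σ N F →+ AntiTensor σ N' F' :=
  lift σ (((tmulHom σ).compl₂ g.toAddMonoidHom).comp f.toAddMonoidHom) (fun n a x => by
    simp [AddMonoidHom.compl₂, smul_tmul])

@[simp]
theorem map_tmul (f : N →ₗ[B] N') (g : F →ₗ[A] F') (n : N) (x : F) :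
    map σ f g (tmul σ n x) = tmul σ (f n) (g x) := rfl

theorem map_map (f : N →ₗ[B] N') (g : F →ₗ[A] F') (f' : N' →ₗ[B] N'') (g' : F' →ₗ[A] F'')
    (t : AntiTensor σ N F) : map σ f' g' (map σ f g t) = map σ (f' ∘ₗ f) (g' ∘ₗ g) t := by
  have h : (map σ f' g').comp (map σ f g) = map σ (f' ∘ₗ f) (g' ∘ₗ g) :=
    hom_ext fun _ _ => rfl
  exact DFunLike.congr_fun h t

theorem map_comm (f : N →ₗ[B] N') (g : F →ₗ[A] F') (t : AntiTensor σ N F) :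
    map σ f .id (map σ .id g t) = map σ .id g (map σ f .id t) := by
  simp [map_map]

theorem map_surjective {f : N →ₗ[B] N'} {g : F →ₗ[A] F'} (hf : Function.Surjective f)
    (hg : Function.Surjective g) : Function.Surjective (map σ f g) := by
  intro t
  induction t using induction_on with
  | zero => exact ⟨0, map_zero _⟩
  | tmul n x =>
    obtain ⟨n, rfl⟩ := hf n
    obtain ⟨x, rfl⟩ := hg x
    exact ⟨tmul σ n x, rfl⟩
  | add s t hs ht =>
    obtain ⟨s, rfl⟩ := hs
    obtain ⟨t, rfl⟩ := ht
    exact ⟨s + t, map_add _ _ _⟩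

theorem map_eq_zero_of_comp_left {f : N →ₗ[B] N'} {g : N' →ₗ[B] N''} (h : ∀ n, g (f n) = 0)
    (t : AntiTensor σ N F) :
    map σ g (.id : F →ₗ[A] F) (map σ f .id t) = 0 := by
  have : g ∘ₗ f = 0 := LinearMap.ext h
  rw [map_map, this]
  exact DFunLike.congr_fun (hom_ext (g := (0 : AntiTensor σ N F →+ AntiTensor σ N'' F))
    fun _ _ => zero_tmul σ _) t

theorem map_eq_zero_of_comp_right {f : F →ₗ[A] F'} {g : F' →ₗ[A] F''} (h : ∀ n, g (f n) = 0)
    (t : AntiTensor σ N F) :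
    map σ (.id : N →ₗ[B] N) g (map σ .id f t) = 0 := by
  have : g ∘ₗ f = 0 := LinearMap.ext h
  rw [map_map, this]
  exact DFunLike.congr_fun (hom_ext (g := (0 : AntiTensor σ N F →+ AntiTensor σ N F''))
    fun _ _ => tmul_zero σ _) t

/-- The tensor product is right exact in the first variable. -/
theorem exact_left {f : N →ₗ[B] N'} {g : N' →ₗ[B] N''} (h : Function.Exact f g)
    (hg : Function.Surjective g) (t : AntiTensor σ N' F)
    (ht : map σ g (.id : F →ₗ[A] F) t = 0) :
    ∃ s, map σ f (.id : F →ₗ[A] F) s = t := by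
  -- Modulo the image I of N ⊗ F, the class of n ⊗ x depends only on g n and x. So the quotient map
  -- q factors as r ∘ (g ⊗ 1) and kills t.
  let I := (map σ f (.id : F →ₗ[A] F)).range
  let q : AntiTensor σ N' F →+ AntiTensor σ N' F ⧸ I := QuotientAddGroup.mk' I
  let b : N' →+ F →+ AntiTensor σ N' F ⧸ I := q.compHom.comp (tmulHom σ)
  have hb : g.toAddMonoidHom.ker ≤ b.ker := by
    intro n hn
    obtain ⟨m, rfl⟩ := (h n).1 hn
    ext x
    exact (QuotientAddGroup.eq_zero_iff _).2 ⟨tmul σ m x, rfl⟩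
  let c : N'' →+ F →+ AntiTensor σ N' F ⧸ I := g.toAddMonoidHom.liftOfRightInverse
    (Function.surjInv hg) (Function.rightInverse_surjInv hg) ⟨b, hb⟩
  have hc : ∀ n, c (g n) = b n := fun n =>
    g.toAddMonoidHom.liftOfRightInverse_comp_apply
      (Function.surjInv hg) (Function.rightInverse_surjInv hg) ⟨b, hb⟩ n
  let r : AntiTensor σ N'' F →+ AntiTensor σ N' F ⧸ I := lift σ c (by
    intro n a x
    obtain ⟨n, rfl⟩ := hg n
    rw [← map_smul, hc, hc]
    exact congrArg q (smul_tmul σ n a x))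
  have hr : r.comp (map σ g .id) = q := hom_ext fun n x => DFunLike.congr_fun (hc n) x
  have : q t = 0 := by
    rw [← hr]
    simp [ht]
  exact (QuotientAddGroup.eq_zero_iff _).1 this

/-- The tensor product is right exact in the second variable. -/
theorem exact_right {f : F →ₗ[A] F'} {g : F' →ₗ[A] F''} (h : Function.Exact f g)
    (hg : Function.Surjective g) (t : AntiTensor σ N F')
    (ht : map σ (.id : N →ₗ[B] N) g t = 0) :
    ∃ s, map σ (.id : N →ₗ[B] N) f s = t := by
  let I := (map σ (.id : N →ₗ[B] N) f).range
  let q : AntiTensor σ N F' →+ AntiTensor σ N F' ⧸ I := QuotientAddGroup.mk' I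
  let b : F' →+ N →+ AntiTensor σ N F' ⧸ I := (q.compHom.comp (tmulHom σ)).flip
  have hb : g.toAddMonoidHom.ker ≤ b.ker := by
    intro n hn
    obtain ⟨m, rfl⟩ := (h n).1 hn
    ext x
    exact (QuotientAddGroup.eq_zero_iff _).2 ⟨tmul σ x m, rfl⟩
  let c : F'' →+ N →+ AntiTensor σ N F' ⧸ I := g.toAddMonoidHom.liftOfRightInverse
    (Function.surjInv hg) (Function.rightInverse_surjInv hg) ⟨b, hb⟩
  have hc : ∀ n, c (g n) = b n := fun n =>
    g.toAddMonoidHom.liftOfRightInverse_comp_apply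
      (Function.surjInv hg) (Function.rightInverse_surjInv hg) ⟨b, hb⟩ n
  let r : AntiTensor σ N F'' →+ AntiTensor σ N F' ⧸ I := lift σ c.flip (by
    intro n a x
    obtain ⟨x, rfl⟩ := hg x
    simp only [AddMonoidHom.flip_apply]
    rw [← map_smul, hc, hc]
    exact congrArg q (smul_tmul σ n a x))
  have hr : r.comp (map σ .id g) = q := hom_ext fun n x => DFunLike.congr_fun (hc x) n
  have : q t = 0 := by
    rw [← hr]
    simp [ht]
  exact (QuotientAddGroup.eq_zero_iff _).1 this

/-- The map `N ⊗ A^(ι) → N^(ι)`. -/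
noncomputable def toFinsuppRight (ι : Type v₃) (N : Type v₁) [AddCommGroup N] [Module B N] :
    AntiTensor σ N (ι →₀ A) →+ (ι →₀ N) :=
  lift σ (AddMonoidHom.mk' (fun n => Finsupp.mapRange.addMonoidHom
      (AddMonoidHom.mk' (fun a : A => (σ a).unop • n) (fun a b => by simp [add_smul])))
      (fun n m => by ext; simp)) (by
    intro n a x
    ext i
    simp [mul_smul])

/-- The map `N^(ι) → N ⊗ A^(ι)`. -/
noncomputable def ofFinsuppRight (ι : Type v₃) (N : Type v₁) [AddCommGroup N] [Module B N] :
    (ι →₀ N) →+ AntiTensor σ N (ι →₀ A) :=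
  Finsupp.liftAddHom fun i => (tmulHom σ).flip (Finsupp.single i 1)

theorem toFinsuppRight_injective (ι : Type v₃) (N : Type v₁) [AddCommGroup N] [Module B N] :
    Function.Injective (toFinsuppRight σ ι N) := by
  refine Function.LeftInverse.injective (g := ofFinsuppRight σ ι N) fun t => ?_
  suffices h : (ofFinsuppRight σ ι N).comp (toFinsuppRight σ ι N) = AddMonoidHom.id _ from
    DFunLike.congr_fun h t
  refine hom_ext fun n f => ?_
  induction f using Finsupp.induction_linear with
  | zero => simp [tmul_zero]
  | add f g hf hg => rw [tmul_add, map_add, map_add, hf, hg]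
  | single i a => simp [toFinsuppRight, ofFinsuppRight, smul_tmul]

/-- The map `B^(ι) ⊗ F → F^(ι)`. -/
noncomputable def toFinsuppLeft (ι : Type v₃) (F : Type v₂) [AddCommGroup F] [Module A F] :
    AntiTensor σ (ι →₀ B) F →+ (ι →₀ F) :=
  lift σ (AddMonoidHom.flip (AddMonoidHom.mk' (fun x : F => Finsupp.mapRange.addMonoidHom
      ((((smulAddHom A F).flip x).comp σ.symm.toAddMonoidHom).comp
        MulOpposite.opAddEquiv.toAddMonoidHom : B →+ F))
      (fun n m => by ext; simp) : F →+ (ι →₀ B) →+ (ι →₀ F))) (by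
    intro n a x
    ext i
    simp [mul_smul])

@[simp]
theorem toFinsuppLeft_tmul {ι : Type v₃} (f : ι →₀ B) (x : F) (i : ι) :
    toFinsuppLeft σ ι F (tmul σ f x) i = σ.symm (.op (f i)) • x := rfl

end AntiTensor

end AntiTensor

/-! ### Flatness, vanishing of Tor and flat resolutions -/

section TorVanish

variable {A B : Type u} [Ring A] [Ring B] (σ : A ≃+* Bᵐᵒᵖ)

/-- Flatness of an `A`-module with respect to `AntiTensor`, tested in one universe. -/
def AntiTensor.FlatLeft (F : Type v) [AddCommGroup F] [Module A F] : Prop :=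
  ∀ (N N' : Type v) [AddCommGroup N] [Module B N] [AddCommGroup N'] [Module B N']
    (f : N →ₗ[B] N'), Function.Injective f →
      Function.Injective (AntiTensor.map σ f (.id : F →ₗ[A] F))

/-- Flatness of a `B`-module with respect to `AntiTensor`, tested in one universe. -/
def AntiTensor.FlatRight (F : Type v) [AddCommGroup F] [Module B F] : Prop :=
  ∀ (N N' : Type v) [AddCommGroup N] [Module A N] [AddCommGroup N'] [Module A N']
    (f : N →ₗ[A] N'), Function.Injective f →
      Function.Injective (AntiTensor.map σ (.id : F →ₗ[B] F) f)

namespace AntiTensor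

/-- Tensoring with a free module embeds naturally into N ↦ N^(ι), which preserves injectivity. -/
theorem flatLeft_finsupp (ι : Type (max u w)) :
    FlatLeft.{u, max u w} σ (ι →₀ A) := by
  intro N N' _ _ _ _ f hf
  have h : ∀ t, toFinsuppRight σ ι N' (map σ f .id t) =
      Finsupp.mapRange f f.map_zero (toFinsuppRight σ ι N t) := by
    intro t
    induction t using induction_on with
    | zero => simp
    | tmul n x => ext i; simp [toFinsuppRight]
    | add s t hs ht =>
      rw [map_add, map_add, hs, ht, map_add, Finsupp.mapRange_add f.map_add]
  intro s t hst
  apply toFinsuppRight_injective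
  apply Finsupp.mapRange_injective f f.map_zero hf
  rw [← h, ← h, hst]

theorem eq_zero_of_subsingleton_left {N : Type v₁} [AddCommGroup N] [Module B N]
    [Subsingleton N] {F : Type v₂} [AddCommGroup F] [Module A F] (t : AntiTensor σ N F) :
    t = 0 := by
  induction t using induction_on with
  | zero => rfl
  | tmul n x => rw [Subsingleton.elim n 0, zero_tmul]
  | add s t hs ht => rw [hs, ht, add_zero]

theorem eq_zero_of_subsingleton_right {N : Type v₁} [AddCommGroup N] [Module B N]
    {F : Type v₂} [AddCommGroup F] [Module A F] [Subsingleton F] (t : AntiTensor σ N F) :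
    t = 0 := by
  induction t using induction_on with
  | zero => rfl
  | tmul n x => rw [Subsingleton.elim x 0, tmul_zero]
  | add s t hs ht => rw [hs, ht, add_zero]

theorem FlatLeft.of_subsingleton (F : Type v) [AddCommGroup F] [Module A F] [Subsingleton F] :
    FlatLeft σ F := fun _ _ _ _ _ _ _ _ s t _ =>
  (eq_zero_of_subsingleton_right σ s).trans (eq_zero_of_subsingleton_right σ t).symm

variable {N P K : Type v} [AddCommGroup N] [Module B N] [AddCommGroup P] [Module B P]
  [AddCommGroup K] [Module B K]
  {M Q L : Type v} [AddCommGroup M] [Module A M] [AddCommGroup Q] [Module A Q]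
  [AddCommGroup L] [Module A L]

/-- For exact sequences `K → P → N → 0` and `L → Q → M → 0`: if `P ⊗ L → P ⊗ Q` and
`K ⊗ M → P ⊗ M` are injective, so is `N ⊗ L → N ⊗ Q`. -/
theorem injective_right_of_left {k : K →ₗ[B] P} {p : P →ₗ[B] N} (hkp : Function.Exact k p)
    (hp : Function.Surjective p) {l : L →ₗ[A] Q} {q : Q →ₗ[A] M} (hlq : Function.Exact l q)
    (hq : Function.Surjective q)
    (hP : Function.Injective (map σ (.id : P →ₗ[B] P) l))
    (h : Function.Injective (map σ k (.id : M →ₗ[A] M))) :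
    Function.Injective (map σ (.id : N →ₗ[B] N) l) := by
  -- Lift x to P ⊗ L. Its image in P ⊗ Q comes from some y in K ⊗ Q, which dies in K ⊗ M by `h` and
  -- so comes from z in K ⊗ L. By `hP` the lift is the image of z, which vanishes in N ⊗ L.
  refine (injective_iff_map_eq_zero _).2 fun x hx => ?_
  obtain ⟨x, rfl⟩ := map_surjective σ hp (g := (.id : L →ₗ[A] L)) Function.surjective_id x
  rw [← map_comm] at hx
  obtain ⟨y, hy⟩ := exact_left σ hkp hp _ hx
  have hy0 : map σ (.id : K →ₗ[B] K) q y = 0 := by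
    apply h
    rw [map_comm, hy, map_eq_zero_of_comp_right σ fun n => (hlq _).2 ⟨n, rfl⟩, map_zero]
  obtain ⟨z, rfl⟩ := exact_right σ hlq hq y hy0
  rw [map_comm] at hy
  rw [← hP hy]
  exact map_eq_zero_of_comp_left σ (fun n => (hkp _).2 ⟨n, rfl⟩) z

/-- For exact sequences `K → P → N → 0` and `L → Q → M → 0`: if `K ⊗ Q → P ⊗ Q` and
`N ⊗ L → N ⊗ Q` are injective, so is `K ⊗ M → P ⊗ M`. -/
theorem injective_left_of_right {k : K →ₗ[B] P} {p : P →ₗ[B] N} (hkp : Function.Exact k p)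
    (hp : Function.Surjective p) {l : L →ₗ[A] Q} {q : Q →ₗ[A] M} (hlq : Function.Exact l q)
    (hq : Function.Surjective q)
    (hQ : Function.Injective (map σ k (.id : Q →ₗ[A] Q)))
    (h : Function.Injective (map σ (.id : N →ₗ[B] N) l)) :
    Function.Injective (map σ k (.id : M →ₗ[A] M)) := by
  refine (injective_iff_map_eq_zero _).2 fun x hx => ?_
  obtain ⟨x, rfl⟩ := map_surjective σ (f := (.id : K →ₗ[B] K)) Function.surjective_id hq x
  rw [map_comm] at hx
  obtain ⟨y, hy⟩ := exact_right σ hlq hq _ hx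
  have hy0 : map σ p (.id : L →ₗ[A] L) y = 0 := by
    apply h
    rw [← map_comm, hy, map_eq_zero_of_comp_left σ fun n => (hkp _).2 ⟨n, rfl⟩, map_zero]
  obtain ⟨z, rfl⟩ := exact_left σ hkp hp y hy0
  rw [← map_comm] at hy
  rw [← hQ hy]
  exact map_eq_zero_of_comp_right σ (fun n => (hlq _).2 ⟨n, rfl⟩) z

/-- The vanishing of `Tor_{n+1}(N, M)`, expressed by dimension shifting along all surjections from
flat modules. -/
def TorVanish (N : Type v) [AddCommGroup N] [Module B N] :
    ℕ → ∀ (M : Type v) [AddCommGroup M] [Module A M], Prop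
  | 0, M, _, _ => ∀ (Q : Type v) [AddCommGroup Q] [Module A Q] (q : Q →ₗ[A] M), FlatLeft σ Q →
      Function.Surjective q →
        Function.Injective (map σ (.id : N →ₗ[B] N) (LinearMap.ker q).subtype)
  | n + 1, M, _, _ => ∀ (Q : Type v) [AddCommGroup Q] [Module A Q] (q : Q →ₗ[A] M),
      FlatLeft σ Q → Function.Surjective q → TorVanish N n (LinearMap.ker q)

theorem exact_ker_subtype {S : Type*} [Ring S] {M N : Type*} [AddCommGroup M] [Module S M]
    [AddCommGroup N] [Module S N] (f : M →ₗ[S] N) :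
    Function.Exact (LinearMap.ker f).subtype f := by
  intro x
  simp

/-- Balance of Tor_1: a single flat cover of N decides the condition for all flat covers of M. -/
theorem torVanish_zero_of_injective {p : P →ₗ[B] N} (hp : Function.Surjective p)
    (hP : FlatRight σ P)
    (h : Function.Injective (map σ (LinearMap.ker p).subtype (.id : M →ₗ[A] M))) :
    TorVanish σ N 0 M := fun _ _ _ q _ hq =>
  injective_right_of_left σ (exact_ker_subtype p) hp (exact_ker_subtype q) hq
    (hP _ _ _ Subtype.val_injective) h

/-- Dimension shifting in the first variable, whereas `TorVanish` is defined by shifting in the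
second. -/
theorem TorVanish.succ_of_ker {p : P →ₗ[B] N} (hp : Function.Surjective p)
    (hP : FlatRight σ P) (n : ℕ) : ∀ (M : Type v) [AddCommGroup M] [Module A M],
    TorVanish σ (LinearMap.ker p) n M → TorVanish σ N (n + 1) M := by
  induction n with
  | zero =>
    intro M _ _ h Q _ _ q hQ hq
    refine torVanish_zero_of_injective σ hp hP ?_
    have h₁ := hP _ _ (LinearMap.ker q).subtype Subtype.val_injective
    -- With K = ker p and L = ker q, the injective composite K ⊗ L → K ⊗ Q → P ⊗ Q factors through K
    -- ⊗ L → P ⊗ L.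
    have h₂ := (hQ _ _ (LinearMap.ker p).subtype Subtype.val_injective).comp (h Q q hQ hq)
    intro s t hst
    apply h₂
    simp only [Function.comp_apply]
    rw [map_comm, map_comm, hst]
  | succ n ih =>
    intro M _ _ h Q _ _ q hQ hq
    exact ih _ (h Q q hQ hq)

end AntiTensor

/-- The flat dimension is at most `n - 1`, for a notion `flat` of flatness. -/
def HasFlatResolution (S : Type u) [Ring S]
    (flat : ∀ (F : Type (max u v)) [AddCommGroup F] [Module S F], Prop)
    (M : Type v) [AddCommGroup M] [Module S M] (n : ℕ) : Prop :=
  ∃ P : LeftResolution S M, (∀ i, flat (P.X i)) ∧ ∀ i, n ≤ i → Subsingleton (P.X i)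

/-- The resolution `⋯ → X 2 → X 1 → ker aug → 0` obtained by cutting off the augmentation. -/
def LeftResolution.tail {S : Type u} [Ring S] {M : Type (max u v)} [AddCommGroup M] [Module S M]
    (P : LeftResolution.{u, max u v} S M) :
    LeftResolution.{u, max u v} S (LinearMap.ker P.aug) where
  X i := P.X (i + 1)
  d i := P.d (i + 1)
  aug := (P.d 0).codRestrict _ fun x => (P.exact_zero _).2 ⟨x, rfl⟩
  aug_surjective := by
    rintro ⟨x, hx⟩
    obtain ⟨y, rfl⟩ := (P.exact_zero x).1 hx
    exact ⟨y, rfl⟩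
  exact_zero x := by
    rw [← P.exact_succ 0 x]
    exact Subtype.ext_iff
  exact_succ i := P.exact_succ (i + 1)

/-- The modules of `LeftResolution.cons`. -/
def LeftResolution.consX (F : Type w) (X : ℕ → Type w) : ℕ → Type w
  | 0 => F
  | i + 1 => X i

instance {F : Type w} {X : ℕ → Type w} [h₀ : AddCommGroup F] [h : ∀ i, AddCommGroup (X i)] :
    ∀ i, AddCommGroup (LeftResolution.consX F X i)
  | 0 => h₀
  | i + 1 => h i

instance {S : Type u} [Ring S] {F : Type w} {X : ℕ → Type w} [AddCommGroup F]
    [∀ i, AddCommGroup (X i)] [h₀ : Module S F] [h : ∀ i, Module S (X i)] :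
    ∀ i, Module S (LeftResolution.consX F X i)
  | 0 => h₀
  | i + 1 => h i

/-- The differentials of `LeftResolution.cons`. -/
def LeftResolution.consD {S : Type u} [Ring S] {F : Type w} {X : ℕ → Type w} [AddCommGroup F]
    [∀ i, AddCommGroup (X i)] [Module S F] [∀ i, Module S (X i)] (g : X 0 →ₗ[S] F)
    (d : ∀ i, X (i + 1) →ₗ[S] X i) :
    ∀ i, LeftResolution.consX F X (i + 1) →ₗ[S] LeftResolution.consX F X i
  | 0 => g
  | i + 1 => d i

/-- Splicing a resolution of the kernel of a surjection `f : F → M` with `f`. -/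
def LeftResolution.cons {S : Type u} [Ring S] {M F : Type (max u v)} [AddCommGroup M] [Module S M]
    [AddCommGroup F] [Module S F] (f : F →ₗ[S] M) (hf : Function.Surjective f)
    (P : LeftResolution.{u, max u v} S (LinearMap.ker f)) :
    LeftResolution.{u, max u v} S M where
  X := consX F P.X
  d := consD ((LinearMap.ker f).subtype ∘ₗ P.aug) P.d
  aug := f
  aug_surjective := hf
  exact_zero x := by
    constructor
    · intro hx
      obtain ⟨y, hy⟩ := P.aug_surjective ⟨x, hx⟩
      exact ⟨y, congrArg Subtype.val hy⟩
    · rintro ⟨y, rfl⟩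
      exact (P.aug y).2
  exact_succ
    | 0 => fun x => by
      refine Iff.trans ?_ (P.exact_zero x)
      exact (Subtype.ext_iff (a1 := P.aug x) (a2 := 0)).symm
    | i + 1 => P.exact_succ i

/-- The zero resolution of the zero module. -/
def LeftResolution.ofSubsingleton (S : Type u) [Ring S] (M : Type v) [AddCommGroup M]
    [Module S M] [Subsingleton M] : LeftResolution S M where
  X _ := PUnit
  d _ := 0
  aug := 0
  aug_surjective _ := ⟨0, Subsingleton.elim _ _⟩
  exact_zero _ := ⟨fun _ => ⟨0, rfl⟩, fun _ => Subsingleton.elim _ _⟩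
  exact_succ _ _ := ⟨fun _ => ⟨0, rfl⟩, fun _ => rfl⟩

namespace AntiTensor

/-- Each passage to a syzygy of N lowers the Tor degree by one, until the flat cover has zero
kernel. -/
theorem torVanish_of_hasFlatResolution (n : ℕ) :
    ∀ (N : Type (max u w)) [AddCommGroup N] [Module B N],
      HasFlatResolution.{u, max u w} B (FlatRight σ) N (n + 1) →
      ∀ (M : Type (max u w)) [AddCommGroup M] [Module A M], TorVanish σ N n M := by
  induction n with
  | zero =>
    rintro N _ _ ⟨P, hP, hs⟩ M _ _
    refine torVanish_zero_of_injective σ P.aug_surjective (hP 0) fun s t _ => ?_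
    have := hs 1 le_rfl
    have : Subsingleton (LinearMap.ker P.aug) :=
      P.tail.aug_surjective.subsingleton (α := P.X 1)
    exact (eq_zero_of_subsingleton_left σ s).trans (eq_zero_of_subsingleton_left σ t).symm
  | succ n ih =>
    rintro N _ _ ⟨P, hP, hs⟩ M _ _
    refine TorVanish.succ_of_ker σ P.aug_surjective (hP 0) n M (ih _ ?_ M)
    exact ⟨P.tail, fun i => hP (i + 1), fun i hi => hs (i + 1) (Nat.succ_le_succ hi)⟩

end AntiTensor

theorem HasFlatResolution.of_flat {S : Type u} [Ring S]
    {flat : ∀ (F : Type (max u w)) [AddCommGroup F] [Module S F], Prop}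
    (hflat : ∀ (F : Type (max u w)) [AddCommGroup F] [Module S F] [Subsingleton F], flat F)
    (M : Type (max u w)) [AddCommGroup M] [Module S M] (hM : flat M) :
    HasFlatResolution.{u, max u w} S flat M 1 := by
  have : Subsingleton (LinearMap.ker (.id : M →ₗ[S] M)) := by
    rw [LinearMap.ker_id]; infer_instance
  refine ⟨.cons .id Function.surjective_id (.ofSubsingleton S _), ?_, ?_⟩
  · rintro (_ | i)
    · exact hM
    · exact hflat PUnit.{max (u + 1) (w + 1)}
  · rintro (_ | i) hi
    · omega
    · exact inferInstanceAs (Subsingleton PUnit)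

theorem HasFlatResolution.succ_of_ker {S : Type u} [Ring S]
    {flat : ∀ (F : Type (max u w)) [AddCommGroup F] [Module S F], Prop}
    {M F : Type (max u w)} [AddCommGroup M] [Module S M] [AddCommGroup F] [Module S F]
    (f : F →ₗ[S] M) (hf : Function.Surjective f) (hF : flat F) (n : ℕ)
    (h : HasFlatResolution.{u, max u w} S flat (LinearMap.ker f) n) :
    HasFlatResolution.{u, max u w} S flat M (n + 1) := by
  obtain ⟨P, hP, hs⟩ := h
  refine ⟨.cons f hf P, ?_, ?_⟩
  · rintro (_ | i)
    · exact hF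
    · exact hP i
  · rintro (_ | i) hi
    · omega
    · exact hs i (Nat.succ_le_succ_iff.1 hi)

end TorVanish

/-! ### Gradings described by projections -/

section Gradings

variable {Γ : Type v}

/-- A decomposition of an additive group as a direct sum, expressed through the existence of the
projections. -/
structure IsGrading {M : Type w} [AddCommGroup M] (ℳ : Γ → AddSubgroup M) : Prop where
  iSup_eq_top : ⨆ γ, ℳ γ = ⊤
  exists_proj : ∃ p : Γ → M →+ M, ∀ γ, (∀ x ∈ ℳ γ, p γ x = x) ∧
    ∀ δ, δ ≠ γ → ∀ x ∈ ℳ δ, p γ x = 0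

namespace IsGrading

variable {M : Type w} [AddCommGroup M] {ℳ : Γ → AddSubgroup M} (h : IsGrading ℳ)
  {M' : Type w} [AddCommGroup M'] {ℳ' : Γ → AddSubgroup M'} (h' : IsGrading ℳ')

/-- The projections of a grading. -/
noncomputable def proj (γ : Γ) : M →+ M := h.exists_proj.choose γ

@[elab_as_elim]
theorem induction_on (h : IsGrading ℳ) {p : M → Prop} (x : M) (mem : ∀ γ, ∀ x ∈ ℳ γ, p x)
    (zero : p 0)
    (add : ∀ x y, p x → p y → p (x + y)) : p x :=
  AddSubgroup.iSup_induction ℳ (C := p) (h.iSup_eq_top ▸ AddSubgroup.mem_top x) mem zero add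

theorem proj_of_mem {γ : Γ} {x : M} (hx : x ∈ ℳ γ) : h.proj γ x = x :=
  (h.exists_proj.choose_spec γ).1 x hx

theorem proj_of_mem_ne {γ δ : Γ} (hne : δ ≠ γ) {x : M} (hx : x ∈ ℳ δ) : h.proj γ x = 0 :=
  (h.exists_proj.choose_spec γ).2 δ hne x hx

theorem proj_mem (γ : Γ) (x : M) : h.proj γ x ∈ ℳ γ := by
  induction x using h.induction_on with
  | mem δ x hx =>
    by_cases hne : δ = γ
    · subst hne
      rwa [h.proj_of_mem hx]
    · rw [h.proj_of_mem_ne hne hx]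
      exact zero_mem _
  | zero => rw [map_zero]; exact zero_mem _
  | add x y hx hy => rw [map_add]; exact add_mem hx hy

theorem exists_sum (x : M) : ∃ s : Finset Γ, ∀ t, s ⊆ t → ∑ γ ∈ t, h.proj γ x = x := by
  classical
  induction x using h.induction_on with
  | mem δ x hx =>
    refine ⟨{δ}, fun t ht => ?_⟩
    rw [Finset.sum_eq_single_of_mem δ (ht (Finset.mem_singleton_self δ)), h.proj_of_mem hx]
    exact fun γ _ hne => h.proj_of_mem_ne hne.symm hx
  | zero => exact ⟨∅, by simp⟩
  | add x y hx hy =>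
    obtain ⟨s, hs⟩ := hx
    obtain ⟨s', hs'⟩ := hy
    refine ⟨s ∪ s', fun t ht => ?_⟩
    simp only [map_add, Finset.sum_add_distrib]
    rw [hs t (Finset.union_subset_left ht), hs' t (Finset.union_subset_right ht)]

theorem map_proj (φ : M →+ M') (hφ : ∀ γ, ∀ x ∈ ℳ γ, φ x ∈ ℳ' γ) (γ : Γ) (x : M) :
    φ (h.proj γ x) = h'.proj γ (φ x) := by
  induction x using h.induction_on with
  | mem δ x hx =>
    by_cases hne : δ = γ
    · subst hne
      rw [h.proj_of_mem hx, h'.proj_of_mem (hφ _ _ hx)]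
    · rw [h.proj_of_mem_ne hne hx, h'.proj_of_mem_ne hne (hφ _ _ hx), map_zero]
  | zero => simp
  | add x y hx hy => simp only [map_add, hx, hy]

/-- Gradings restrict to subgroups stable under the projections. -/
theorem comap_of_proj_mem {L : Type*} [AddCommGroup L] (i : L →+ M) (hi : Function.Injective i)
    (hL : ∀ γ y, ∃ z, i z = h.proj γ (i y)) : IsGrading fun γ => (ℳ γ).comap i := by
  choose g hg using hL
  refine ⟨eq_top_iff.2 fun y _ => ?_, ?_⟩
  · obtain ⟨s, hs⟩ := h.exists_sum (i y)
    have : y = ∑ γ ∈ s, g γ y := by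
      apply hi
      rw [map_sum, ← hs s subset_rfl]
      exact Finset.sum_congr rfl fun γ _ => (hs s subset_rfl).symm ▸ (hg γ y).symm
    rw [this]
    refine sum_mem fun γ _ => AddSubgroup.mem_iSup_of_mem γ ?_
    rw [AddSubgroup.mem_comap, hg]
    exact h.proj_mem γ _
  · refine ⟨fun γ => AddMonoidHom.mk' (g γ) fun x y => hi (by simp [hg]), fun γ => ⟨?_, ?_⟩⟩
    · intro x hx
      exact hi ((hg γ x).trans (h.proj_of_mem hx))
    · intro δ hne x hx
      exact hi ((hg γ x).trans ((h.proj_of_mem_ne hne hx).trans (map_zero i).symm))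

/-- Gradings pass to quotients by subgroups stable under the projections. -/
theorem map_of_proj_mem {Q : Type*} [AddCommGroup Q] (q : M →+ Q) (hq : Function.Surjective q)
    (hL : ∀ γ x, q x = 0 → q (h.proj γ x) = 0) : IsGrading fun γ => (ℳ γ).map q := by
  refine ⟨?_, ?_⟩
  · rw [← AddSubgroup.map_iSup, h.iSup_eq_top, ← AddMonoidHom.range_eq_map,
      AddMonoidHom.range_eq_top.2 hq]
  · let p (γ : Γ) : Q →+ Q := q.liftOfRightInverse (Function.surjInv hq)
      (Function.rightInverse_surjInv hq) ⟨q.comp (h.proj γ), fun x hx => hL γ x hx⟩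
    have hp (γ : Γ) (x : M) : p γ (q x) = q (h.proj γ x) :=
      q.liftOfRightInverse_comp_apply (Function.surjInv hq)
        (Function.rightInverse_surjInv hq) ⟨q.comp (h.proj γ), fun x hx => hL γ x hx⟩ x
    refine ⟨p, fun γ => ⟨?_, ?_⟩⟩
    · rintro _ ⟨x, hx, rfl⟩
      rw [hp, h.proj_of_mem hx]
    · rintro δ hne _ ⟨x, hx, rfl⟩
      rw [hp, h.proj_of_mem_ne hne hx, map_zero]

/-- Kernels, quotients and free modules are graded more easily by exhibiting projections than by
inverting the map from the direct sum. -/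
theorem isInternal_iff [DecidableEq Γ] : DirectSum.IsInternal ℳ ↔ IsGrading ℳ := by
  constructor
  · intro hi
    let e := AddEquiv.ofBijective (DirectSum.coeAddMonoidHom ℳ) hi
    have he (δ : Γ) (x : M) (hx : x ∈ ℳ δ) :
        e.symm x = DirectSum.of (fun γ => ℳ γ) δ ⟨x, hx⟩ := by
      rw [AddEquiv.symm_apply_eq]
      exact (DirectSum.coeAddMonoidHom_of ℳ δ ⟨x, hx⟩).symm
    refine ⟨eq_top_iff.2 fun x _ => ?_, ?_⟩
    · obtain ⟨f, rfl⟩ := hi.2 x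
      induction f using DirectSum.induction_on with
      | zero => rw [map_zero]; exact zero_mem _
      | of γ x =>
        rw [DirectSum.coeAddMonoidHom_of]
        exact AddSubgroup.mem_iSup_of_mem γ x.2
      | add f g hf hg => rw [map_add]; exact add_mem (hf trivial) (hg trivial)
    refine ⟨fun γ => ((ℳ γ).subtype.comp (DFinsupp.evalAddMonoidHom γ)).comp
      e.symm.toAddMonoidHom, fun γ => ⟨fun x hx => ?_, fun δ hne x hx => ?_⟩⟩
    · have : (e.symm x) γ = ⟨x, hx⟩ := by rw [he γ x hx, DirectSum.of_eq_same]
      exact congrArg Subtype.val this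
    · have : (e.symm x) γ = 0 := by rw [he δ x hx, DirectSum.of_eq_of_ne _ _ _ hne.symm]
      exact congrArg Subtype.val this
  · intro h
    constructor
    · refine (injective_iff_map_eq_zero _).2 fun f hf => ?_
      have key (γ : Γ) : ((h.proj γ).comp (DirectSum.coeAddMonoidHom ℳ)) =
          (ℳ γ).subtype.comp (DFinsupp.evalAddMonoidHom γ) := by
        refine DirectSum.addHom_ext fun δ x => ?_
        simp only [AddMonoidHom.comp_apply, DirectSum.coeAddMonoidHom_of]
        by_cases hne : δ = γ
        · subst hne
          rw [h.proj_of_mem x.2]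
          have : x = (DirectSum.of (fun γ => ℳ γ) δ x) δ := by
            rw [DirectSum.of_eq_same]
          exact congrArg Subtype.val this
        · rw [h.proj_of_mem_ne hne x.2]
          have : 0 = (DirectSum.of (fun γ => ℳ γ) δ x) γ := by
            rw [DirectSum.of_eq_of_ne _ _ _ (Ne.symm hne)]
          exact congrArg Subtype.val this
      refine DFinsupp.ext fun γ => Subtype.ext ?_
      have := DFunLike.congr_fun (key γ) f
      simp only [AddMonoidHom.comp_apply, hf, map_zero] at this
      exact this.symm
    · intro x
      induction x using h.induction_on with
      | mem γ x hx => exact ⟨DirectSum.of _ γ ⟨x, hx⟩, DirectSum.coeAddMonoidHom_of ℳ γ ⟨x, hx⟩⟩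
      | zero => exact ⟨0, map_zero _⟩
      | add x y hx hy =>
        obtain ⟨f, rfl⟩ := hx
        obtain ⟨g, rfl⟩ := hy
        exact ⟨f + g, map_add _ _ _⟩

end IsGrading

end Gradings

/-! ### Graded modules over a semigroup-graded ring -/

section GradedModules

variable {Γ : Type v} [Semigroup Γ] {A B : Type u} [Ring A] [Ring B]

/-- A grading of the ring `A` by a semigroup (with no condition on the unit). -/
structure IsMulGrading (𝒜 : Γ → AddSubgroup A) : Prop where
  isGrading : IsGrading 𝒜
  mul_mem : ∀ (α β : Γ) (a b : A), a ∈ 𝒜 α → b ∈ 𝒜 β → a * b ∈ 𝒜 (α * β)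

/-- A grading of an `A`-module compatible with a grading of `A`. -/
structure IsLeftGrading (𝒜 : Γ → AddSubgroup A) {M : Type w} [AddCommGroup M] [Module A M]
    (ℳ : Γ → AddSubgroup M) : Prop where
  isGrading : IsGrading ℳ
  smul_mem : ∀ (α β : Γ) (a : A) (x : M), a ∈ 𝒜 α → x ∈ ℳ β → a • x ∈ ℳ (α * β)

/-- A grading of a `B`-module compatible with a grading of `A ≃+* Bᵐᵒᵖ`. -/
structure IsRightGrading (σ : A ≃+* Bᵐᵒᵖ) (𝒜 : Γ → AddSubgroup A) {M : Type w} [AddCommGroup M]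
    [Module B M] (ℳ : Γ → AddSubgroup M) : Prop where
  isGrading : IsGrading ℳ
  smul_mem : ∀ (α β : Γ) (x : M) (a : A), x ∈ ℳ α → a ∈ 𝒜 β → (σ a).unop • x ∈ ℳ (α * β)

namespace IsMulGrading

variable [IsCancelMul Γ] {𝒜 : Γ → AddSubgroup A} (h𝒜 : IsMulGrading 𝒜)

/-- The homogeneous elements taking degree `β` to degree `γ`. -/
def shift (_ : IsMulGrading 𝒜) (γ β : Γ) : AddSubgroup A where
  -- The alternative a = 0 matters when no α satisfies α * β = γ.
  carrier := {a | a = 0 ∨ ∃ α, α * β = γ ∧ a ∈ 𝒜 α}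
  zero_mem' := Or.inl rfl
  add_mem' := by
    rintro a b (rfl | ⟨α, hα, ha⟩) (rfl | ⟨α', hα', hb⟩)
    · simp
    · exact Or.inr ⟨α', hα', by simpa using hb⟩
    · exact Or.inr ⟨α, hα, by simpa using ha⟩
    · obtain rfl := mul_right_cancel (hα.trans hα'.symm)
      exact Or.inr ⟨α, hα, add_mem ha hb⟩
  neg_mem' := by
    rintro a (rfl | ⟨α, hα, ha⟩)
    · simp
    · exact Or.inr ⟨α, hα, neg_mem ha⟩

theorem mem_shift_mul {α : Γ} {a : A} (ha : a ∈ 𝒜 α) (β : Γ) : a ∈ h𝒜.shift (α * β) β :=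
  Or.inr ⟨α, rfl, ha⟩

theorem mul_mem_shift {α β γ : Γ} {a b : A} (ha : a ∈ 𝒜 α) (hb : b ∈ h𝒜.shift γ β) :
    a * b ∈ h𝒜.shift (α * γ) β := by
  rcases hb with rfl | ⟨α', rfl, hb⟩
  · rw [mul_zero]; exact zero_mem _
  · exact Or.inr ⟨α * α', mul_assoc _ _ _, h𝒜.mul_mem _ _ _ _ ha hb⟩

open Classical in
/-- The projection onto `shift γ β`. -/
noncomputable def shiftProj (γ β : Γ) : A →+ A :=
  if h : ∃ α, α * β = γ then h𝒜.isGrading.proj h.choose else 0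

theorem shiftProj_of_mem {γ β : Γ} {a : A} (ha : a ∈ h𝒜.shift γ β) : h𝒜.shiftProj γ β a = a := by
  rcases ha with rfl | ⟨α, hα, ha⟩
  · exact map_zero _
  · have h : ∃ α, α * β = γ := ⟨α, hα⟩
    rw [shiftProj, dif_pos h]
    obtain hh : α = h.choose := mul_right_cancel (hα.trans h.choose_spec.symm)
    exact h𝒜.isGrading.proj_of_mem (hh ▸ ha)

theorem shiftProj_of_mem_ne {γ δ β : Γ} (hne : δ ≠ γ) {a : A} (ha : a ∈ h𝒜.shift δ β) :
    h𝒜.shiftProj γ β a = 0 := by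
  rcases ha with rfl | ⟨α, hα, ha⟩
  · exact map_zero _
  · rw [shiftProj]
    split_ifs with h
    · refine h𝒜.isGrading.proj_of_mem_ne (fun hh => hne ?_) ha
      rw [← hα, hh, h.choose_spec]
    · rfl

variable {M : Type w} [AddCommGroup M] [Module A M] {ℳ : Γ → AddSubgroup M}

theorem shift_smul_mem (hℳ : IsLeftGrading 𝒜 ℳ) {γ β : Γ} {a : A} (ha : a ∈ h𝒜.shift γ β)
    {x : M} (hx : x ∈ ℳ β) : a • x ∈ ℳ γ := by
  rcases ha with rfl | ⟨α, rfl, ha⟩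
  · rw [zero_smul]; exact zero_mem _
  · exact hℳ.smul_mem _ _ _ _ ha hx

/-- By left cancellation a nonzero homogeneous a moves distinct degrees to distinct degrees, so only
the β-component of x contributes to degree γ. -/
theorem shift_smul_proj (hℳ : IsLeftGrading 𝒜 ℳ) {γ β : Γ} {a : A} (ha : a ∈ h𝒜.shift γ β)
    (x : M) : a • hℳ.isGrading.proj β x = hℳ.isGrading.proj γ (a • x) := by
  rcases ha with rfl | ⟨α, rfl, ha⟩
  · simp
  · induction x using hℳ.isGrading.induction_on with
    | mem δ x hx =>
      have hax := hℳ.smul_mem _ _ _ _ ha hx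
      by_cases hne : δ = β
      · subst hne
        rw [hℳ.isGrading.proj_of_mem hx, hℳ.isGrading.proj_of_mem hax]
      · rw [hℳ.isGrading.proj_of_mem_ne hne hx, smul_zero,
          hℳ.isGrading.proj_of_mem_ne (fun hh => hne (mul_left_cancel hh)) hax]
    | zero => simp
    | add x y hx hy => simp only [map_add, smul_add, hx, hy]

/-- The grading of the free module on generators of prescribed degrees. -/
def free {ι : Type w} (deg : ι → Γ) (γ : Γ) : AddSubgroup (ι →₀ A) where
  carrier := {f | ∀ i, f i ∈ h𝒜.shift γ (deg i)}
  zero_mem' _ := zero_mem _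
  add_mem' hf hg i := add_mem (hf i) (hg i)
  neg_mem' hf i := neg_mem (hf i)

/-- The γ-component is taken coordinatewise: at i it is the part of f i in the unique degree α with
α * deg i = γ, or zero if there is none. -/
theorem isLeftGrading_free {ι : Type w} (deg : ι → Γ) : IsLeftGrading 𝒜 (h𝒜.free deg) where
  isGrading := by
    classical
    refine ⟨eq_top_iff.2 fun f _ => ?_, ?_⟩
    · induction f using Finsupp.induction_linear with
      | zero => exact zero_mem _
      | add f g hf hg => exact add_mem (hf trivial) (hg trivial)
      | single i a =>
        induction a using h𝒜.isGrading.induction_on with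
        | mem α a ha =>
          refine AddSubgroup.mem_iSup_of_mem (α * deg i) fun j => ?_
          by_cases hij : i = j
          · subst hij
            rw [Finsupp.single_eq_same]
            exact h𝒜.mem_shift_mul ha _
          · rw [Finsupp.single_eq_of_ne' hij]
            exact zero_mem _
        | zero => rw [Finsupp.single_zero]; exact zero_mem _
        | add a b ha hb => rw [Finsupp.single_add]; exact add_mem (ha trivial) (hb trivial)
    · refine ⟨fun γ => Finsupp.liftAddHom fun i =>
        (Finsupp.singleAddHom i).comp (h𝒜.shiftProj γ (deg i)), fun γ => ⟨?_, ?_⟩⟩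
      · intro f hf
        rw [Finsupp.liftAddHom_apply]
        conv_rhs => rw [← Finsupp.sum_single f]
        refine Finsupp.sum_congr fun i _ => ?_
        exact congrArg (Finsupp.single i) (h𝒜.shiftProj_of_mem (hf i))
      · intro δ hne f hf
        rw [Finsupp.liftAddHom_apply]
        refine Finset.sum_eq_zero fun i _ => ?_
        exact (congrArg (Finsupp.single i) (h𝒜.shiftProj_of_mem_ne hne (hf i))).trans
          (Finsupp.single_zero i)
  smul_mem α β a f ha hf i := h𝒜.mul_mem_shift ha (hf i)

theorem linearCombination_mem (hℳ : IsLeftGrading 𝒜 ℳ) {ι : Type v₁} {deg : ι → Γ} {y : ι → M}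
    (hy : ∀ i, y i ∈ ℳ (deg i)) {γ : Γ} {f : ι →₀ A} (hf : f ∈ h𝒜.free deg γ) :
    Finsupp.linearCombination A y f ∈ ℳ γ :=
  sum_mem fun i _ => h𝒜.shift_smul_mem hℳ (hf i) (hy i)

omit [IsCancelMul Γ] in
/-- A submodule generated by homogeneous elements is stable under the projections. -/
theorem mem_span_proj {σ : A ≃+* Bᵐᵒᵖ} {P : Type w} [AddCommGroup P] [Module B P]
    {𝒩 : Γ → AddSubgroup P} (h𝒜 : IsMulGrading 𝒜) (h𝒩 : IsRightGrading σ 𝒜 𝒩) {S : Set P}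
    (hS : ∀ s ∈ S, ∃ γ, s ∈ 𝒩 γ) (γ : Γ) {x : P} (hx : x ∈ Submodule.span B S) :
    h𝒩.isGrading.proj γ x ∈ Submodule.span B S := by
  -- D is generated by the homogeneous elements of the span. It is stable under homogeneous scalars,
  -- hence under B, and so contains x; on its generators the projection is the identity or zero.
  let D : AddSubgroup P :=
    AddSubgroup.closure {y | y ∈ Submodule.span B S ∧ ∃ δ, y ∈ 𝒩 δ}
  have hD : x ∈ D := by
    induction hx using Submodule.span_induction with
    | mem y hy => exact AddSubgroup.subset_closure ⟨Submodule.subset_span hy, hS y hy⟩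
    | zero => exact zero_mem _
    | add y z _ _ hy hz => exact add_mem hy hz
    | smul b y hy₀ hy =>
      clear hy₀
      obtain ⟨a, rfl⟩ : ∃ a, (σ a).unop = b := ⟨σ.symm (.op b), by simp⟩
      induction hy using AddSubgroup.closure_induction with
      | mem y hy =>
        obtain ⟨hy, δ, hδ⟩ := hy
        induction a using h𝒜.isGrading.induction_on with
        | mem α a ha =>
          exact AddSubgroup.subset_closure
            ⟨Submodule.smul_mem _ _ hy, δ * α, h𝒩.smul_mem _ _ _ _ hδ ha⟩
        | zero => simp
        | add a b ha hb =>
          rw [map_add, MulOpposite.unop_add, add_smul]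
          exact add_mem ha hb
      | zero => simp
      | add y z _ _ hy hz => rw [smul_add]; exact add_mem hy hz
      | neg y _ hy => rw [smul_neg]; exact neg_mem hy
  clear hx
  induction hD using AddSubgroup.closure_induction with
  | mem y hy =>
    obtain ⟨hy, δ, hδ⟩ := hy
    by_cases hne : δ = γ
    · subst hne
      rwa [h𝒩.isGrading.proj_of_mem hδ]
    · rw [h𝒩.isGrading.proj_of_mem_ne hne hδ]
      exact zero_mem _
  | zero => rw [map_zero]; exact zero_mem _
  | add y z _ _ hy hz => rw [map_add]; exact add_mem hy hz
  | neg y _ hy => rw [map_neg]; exact neg_mem hy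

end IsMulGrading

theorem IsLeftGrading.ker {𝒜 : Γ → AddSubgroup A} {M F : Type w} [AddCommGroup M] [Module A M]
    [AddCommGroup F] [Module A F] {ℳ : Γ → AddSubgroup M} {ℱ : Γ → AddSubgroup F}
    (hℳ : IsLeftGrading 𝒜 ℳ) (hℱ : IsLeftGrading 𝒜 ℱ) (q : F →ₗ[A] M)
    (hq : ∀ γ, ∀ x ∈ ℱ γ, q x ∈ ℳ γ) :
    IsLeftGrading 𝒜 fun γ => (ℱ γ).comap (LinearMap.ker q).subtype.toAddMonoidHom where
  isGrading := by
    refine hℱ.isGrading.comap_of_proj_mem _ Subtype.val_injective ?_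
    rintro γ ⟨x, hx⟩
    refine ⟨⟨hℱ.isGrading.proj γ x, ?_⟩, rfl⟩
    have := hℱ.isGrading.map_proj hℳ.isGrading q.toAddMonoidHom hq γ x
    exact this.trans (by rw [LinearMap.toAddMonoidHom_coe, LinearMap.mem_ker.1 hx, map_zero])
  smul_mem α β a x ha hx := hℱ.smul_mem α β a x ha hx

theorem IsRightGrading.quotient {σ : A ≃+* Bᵐᵒᵖ} {𝒜 : Γ → AddSubgroup A} {P : Type w}
    [AddCommGroup P] [Module B P] {𝒩 : Γ → AddSubgroup P} (h𝒩 : IsRightGrading σ 𝒜 𝒩)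
    (J : Submodule B P) (hJ : ∀ γ, ∀ x ∈ J, h𝒩.isGrading.proj γ x ∈ J) :
    IsRightGrading σ 𝒜 fun γ => (𝒩 γ).map J.mkQ.toAddMonoidHom where
  isGrading := by
    refine h𝒩.isGrading.map_of_proj_mem _ J.mkQ_surjective fun γ x hx => ?_
    exact (Submodule.Quotient.mk_eq_zero J).2 (hJ γ x ((Submodule.Quotient.mk_eq_zero J).1 hx))
  smul_mem := by
    rintro α β _ a ⟨x, hx, rfl⟩ ha
    exact ⟨(σ a).unop • x, h𝒩.smul_mem α β x a hx ha, map_smul J.mkQ _ _⟩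

/-- The grading of `B` in a larger universe. -/
def uliftGrading (σ : A ≃+* Bᵐᵒᵖ) (𝒜 : Γ → AddSubgroup A) (γ : Γ) :
    AddSubgroup (ULift.{w} B) :=
  (𝒜 γ).comap ((σ.symm.toAddMonoidHom.comp MulOpposite.opAddEquiv.toAddMonoidHom).comp
    AddEquiv.ulift.toAddMonoidHom)

/-- The lift places the regular right module in the universe of the test modules N. -/
theorem IsMulGrading.isRightGrading_ulift {𝒜 : Γ → AddSubgroup A} (h𝒜 : IsMulGrading 𝒜)
    (σ : A ≃+* Bᵐᵒᵖ) : IsRightGrading σ 𝒜 (uliftGrading.{u, v, w} σ 𝒜) where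
  isGrading := by
    refine h𝒜.isGrading.comap_of_proj_mem _ ?_ ?_
    · exact (σ.symm.injective.comp MulOpposite.op_injective).comp ULift.down_injective
    · intro γ y
      exact ⟨⟨(σ (h𝒜.isGrading.proj γ (σ.symm (.op y.down)))).unop⟩, σ.symm_apply_apply _⟩
  smul_mem α β x a hx ha := by
    have e : σ.symm (.op ((σ a).unop • x).down) = σ.symm (.op x.down) * a := by simp
    change σ.symm (.op ((σ a).unop • x).down) ∈ 𝒜 (α * β)
    rw [e]
    exact h𝒜.mul_mem α β _ _ hx ha

end GradedModules

/-! ### The homogeneous equational criterion for flatness -/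

section GradedFlat

variable {Γ : Type v} [Semigroup Γ] [IsCancelMul Γ] {A B : Type u} [Ring A] [Ring B]
  (σ : A ≃+* Bᵐᵒᵖ) {𝒜 : Γ → AddSubgroup A} (h𝒜 : IsMulGrading 𝒜)

namespace AntiTensor

/-- Evaluation `B ⊗ F → F`. -/
def uliftEval (F : Type v₁) [AddCommGroup F] [Module A F] :
    AntiTensor σ (ULift.{w} B) F →+ F :=
  lift σ ((smulAddHom A F).comp ((σ.symm.toAddMonoidHom.comp
    MulOpposite.opAddEquiv.toAddMonoidHom).comp AddEquiv.ulift.toAddMonoidHom)) (by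
    intro n a x
    change σ.symm (.op ((σ a).unop • n).down) • x = σ.symm (.op n.down) • a • x
    simp [mul_smul])

@[simp]
theorem uliftEval_tmul {F : Type v₁} [AddCommGroup F] [Module A F] (b : ULift.{w} B) (x : F) :
    uliftEval σ F (tmul σ b x) = σ.symm (.op b.down) • x := rfl

theorem apply_toFinsuppLeft {ι : Type v₃} {F M : Type v₁} [AddCommGroup F] [Module A F]
    [AddCommGroup M] [Module A M] (q : F →ₗ[A] M) (t : AntiTensor σ (ι →₀ B) F) (i : ι) :
    q (toFinsuppLeft σ ι F t i) = toFinsuppLeft σ ι M (map σ .id q t) i := by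
  induction t using induction_on with
  | zero => simp
  | tmul f x => simp
  | add s t hs ht => simp only [map_add, Finsupp.add_apply, hs, ht]

/-- Reading a tensor as a family in F, the combination with coefficients c is induced by the map
B^(ι) → B sending the i-th basis vector to c i. Tensors from the kernel of that map thus give
families satisfying the relation c. -/
theorem linearCombination_toFinsuppLeft {ι : Type (max u w)} {F : Type v₁} [AddCommGroup F]
    [Module A F] (c : ι →₀ A) (t : AntiTensor σ (ι →₀ B) F) :
    Finsupp.linearCombination A (fun i => toFinsuppLeft σ ι F t i) c =
      uliftEval.{u, w, v₁} σ F (map σ (Finsupp.linearCombination B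
        fun i => (⟨(σ (c i)).unop⟩ : ULift.{w} B)) .id t) := by
  classical
  have hadd (s t : AntiTensor σ (ι →₀ B) F) :
      Finsupp.linearCombination A (fun i => toFinsuppLeft σ ι F (s + t) i) c =
      Finsupp.linearCombination A (fun i => toFinsuppLeft σ ι F s i) c +
      Finsupp.linearCombination A (fun i => toFinsuppLeft σ ι F t i) c := by
    simp [Finsupp.linearCombination_apply, Finsupp.sum_add]
  have hzero : Finsupp.linearCombination A
      (fun i => toFinsuppLeft σ ι F (0 : AntiTensor σ (ι →₀ B) F) i) c = 0 := by
    simp [Finsupp.linearCombination_apply]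
  induction t using induction_on with
  | zero => rw [hzero]; simp
  | tmul f x =>
    induction f using Finsupp.induction_linear with
    | zero => rw [zero_tmul, hzero]; simp
    | add f g hf hg => rw [add_tmul, hadd, hf, hg, map_add, map_add]
    | single i b =>
      rw [Finsupp.linearCombination_apply, Finsupp.sum_eq_single i]
      · simp [mul_smul]
      · intro j _ hj
        rw [toFinsuppLeft_tmul, Finsupp.single_eq_of_ne hj]
        simp
      · simp
  | add s t hs ht => rw [hadd, hs, ht, map_add, map_add]

end AntiTensor

open AntiTensor

variable {M : Type (max u w)} [AddCommGroup M] [Module A M] {ℳ : Γ → AddSubgroup M}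

/-- If `Tor₁(N, M)` vanishes for all graded `N`, then homogeneous relations in `M` are trivial:
they are killed by a graded endomorphism of a free cover over `M`. -/
theorem IsLeftGrading.exists_endomorphism (hℳ : IsLeftGrading 𝒜 ℳ)
    (hM : ∀ (N : Type (max u w)) [AddCommGroup N] [Module B N] (𝒩 : Γ → AddSubgroup N),
      IsRightGrading σ 𝒜 𝒩 → TorVanish σ N 0 M)
    {ι : Type (max u w)} (deg : ι → Γ) (y : ι → M) (hy : ∀ i, y i ∈ ℳ (deg i))
    (hsurj : Function.Surjective (Finsupp.linearCombination A y))
    {γ : Γ} {c : ι →₀ A} (hc : c ∈ h𝒜.free deg γ) (hc0 : Finsupp.linearCombination A y c = 0) :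
    ∃ φ : (ι →₀ A) →ₗ[A] (ι →₀ A), (∀ γ, ∀ f ∈ h𝒜.free deg γ, φ f ∈ h𝒜.free deg γ) ∧
      Finsupp.linearCombination A y ∘ₗ φ = Finsupp.linearCombination A y ∧ φ c = 0 := by
  classical
  let F : Type (max u w) := ι →₀ A
  let q : F →ₗ[A] M := Finsupp.linearCombination A y
  have hF : IsLeftGrading 𝒜 (h𝒜.free deg) := h𝒜.isLeftGrading_free deg
  have hqF : ∀ γ, ∀ x ∈ h𝒜.free deg γ, q x ∈ ℳ γ := fun γ x hx =>
    h𝒜.linearCombination_mem hℳ hy hx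
  have hU := h𝒜.isRightGrading_ulift.{u, v, w} σ
  let gen : ι → ULift.{w} B := fun i => ⟨(σ (c i)).unop⟩
  let J : Submodule B (ULift.{w} B) := Submodule.span B (Set.range gen)
  have hgen : ∀ s ∈ Set.range gen, ∃ δ, s ∈ uliftGrading.{u, v, w} σ 𝒜 δ := by
    rintro _ ⟨i, rfl⟩
    have hi : σ.symm (.op (gen i).down) = c i := σ.symm_apply_apply _
    rcases hc i with h0 | ⟨α, _, hα⟩
    · refine ⟨γ, ?_⟩
      change σ.symm (.op (gen i).down) ∈ 𝒜 γ
      rw [hi, h0]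
      exact zero_mem _
    · refine ⟨α, ?_⟩
      change σ.symm (.op (gen i).down) ∈ 𝒜 α
      rwa [hi]
  -- This is Tor_1(B/J, M) = 0, available because J has homogeneous generators and B/J is therefore
  -- graded.
  have hJM : Function.Injective (map σ J.subtype (.id : M →ₗ[A] M)) := by
    have hq : Function.Exact (LinearMap.ker q).subtype q := exact_ker_subtype q
    refine injective_left_of_right.{u, max u w} σ (Q := F) (L := LinearMap.ker q) (p := J.mkQ)
      (l := (LinearMap.ker q).subtype) (q := q) ?_ J.mkQ_surjective hq hsurj
      (flatLeft_finsupp.{u, w} σ ι _ _ J.subtype Subtype.val_injective) ?_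
    · intro x
      simp
    · exact hM _ _ (hU.quotient J fun γ x hx => IsMulGrading.mem_span_proj h𝒜 hU hgen γ hx)
        F q (flatLeft_finsupp σ ι) hsurj
  let G : (ι →₀ B) →ₗ[B] ULift.{w} B := Finsupp.linearCombination B gen
  have hGJ : LinearMap.range G = J := Finsupp.range_linearCombination B
  have hG (f : ι →₀ B) : G f ∈ J := hGJ ▸ LinearMap.mem_range_self G f
  let g : (ι →₀ B) →ₗ[B] J := G.codRestrict J hG
  have hg : Function.Surjective g := by
    rintro ⟨x, hx⟩
    obtain ⟨f, rfl⟩ := hGJ.ge hx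
    exact ⟨f, rfl⟩
  -- The image of t₀ in J ⊗ M is Σ c_i ⊗ y_i, which becomes 1 ⊗ Σ c_i y_i = 0 in B ⊗ M.
  let t₀ : AntiTensor σ (ι →₀ B) M := ∑ i ∈ c.support, tmul σ (Finsupp.single i 1) (y i)
  have ht₀ : map σ g (.id : M →ₗ[A] M) t₀ = 0 := by
    apply hJM
    rw [map_zero, map_map]
    change map σ G .id t₀ = 0
    have h1 (i : ι) : map σ G (.id : M →ₗ[A] M) (tmul σ (Finsupp.single i 1) (y i)) =
        tmulHom σ ⟨1⟩ (c i • y i) := by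
      rw [tmulHom_apply, ← smul_tmul, map_tmul]
      congr 1
      simp only [G, gen, Finsupp.linearCombination_single, one_smul]
      exact ULift.ext _ _ (mul_one _).symm
    simp only [t₀, map_sum, h1]
    rw [← map_sum]
    exact (congrArg (tmulHom σ _) hc0).trans (map_zero _)
  -- So t₀ comes from ker g ⊗ M and further lifts to ker g ⊗ F, whose elements are families in F
  -- satisfying the relation c.
  obtain ⟨s, hs⟩ := exact_left.{u, max u w, max u w} σ (N := LinearMap.ker g)
    (f := (LinearMap.ker g).subtype) (exact_ker_subtype g) hg t₀ ht₀
  obtain ⟨s, rfl⟩ := map_surjective σ (N := LinearMap.ker g) (N' := LinearMap.ker g)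
    (f := .id) (g := q) Function.surjective_id hsurj s
  rw [map_comm] at hs
  let e : ι →₀ F := toFinsuppLeft σ ι F (map σ (LinearMap.ker g).subtype .id s)
  have hqe (i : ι) (hi : c i ≠ 0) : q (e i) = y i := by
    rw [apply_toFinsuppLeft, hs]
    simp only [t₀, map_sum, Finsupp.finsetSum_apply, toFinsuppLeft_tmul]
    rw [Finset.sum_eq_single i]
    · simp
    · intro j _ hj
      rw [Finsupp.single_eq_of_ne' hj]
      simp
    · intro h
      exact absurd (Finsupp.notMem_support_iff.1 h) hi
  have hce : Finsupp.linearCombination A (fun i => e i) c = 0 := by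
    rw [linearCombination_toFinsuppLeft.{u, w}]
    change uliftEval σ F (map σ G .id _) = 0
    rw [map_eq_zero_of_comp_left, map_zero]
    exact fun n => congrArg Subtype.val n.2
  -- Off the support of c, t₀ has no i-th term and e i need not lift y i, so the basis vector is
  -- used. Taking the component of degree deg i makes the endomorphism graded.
  let e' : ι → F := fun i => hF.isGrading.proj (deg i)
    (if c i = 0 then Finsupp.single i 1 else e i)
  refine ⟨Finsupp.linearCombination A e', ?_, ?_, ?_⟩
  · exact fun γ f hf => h𝒜.linearCombination_mem hF (fun i => hF.isGrading.proj_mem _ _) hf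
  · refine Finsupp.lhom_ext' fun i => LinearMap.ext_ring ?_
    have h1 : q (e' i) = y i := by
      refine (hF.isGrading.map_proj hℳ.isGrading q.toAddMonoidHom hqF _ _).trans ?_
      rw [LinearMap.toAddMonoidHom_coe]
      split_ifs with h
      · simp only [q, Finsupp.linearCombination_single, one_smul]
        exact hℳ.isGrading.proj_of_mem (hy i)
      · rw [hqe i h]
        exact hℳ.isGrading.proj_of_mem (hy i)
    simpa using h1
  · have h1 := congrArg (hF.isGrading.proj γ) hce
    rw [map_zero, Finsupp.linearCombination_apply, Finsupp.sum, map_sum] at h1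
    rw [Finsupp.linearCombination_apply, Finsupp.sum, ← h1]
    refine Finset.sum_congr rfl fun i hi => ?_
    rw [← h𝒜.shift_smul_proj hF (hc i)]
    simp only [e', if_neg (Finsupp.mem_support_iff.1 hi)]

include h𝒜

/-- If `Tor₁(N, M)` vanishes for all graded `N`, then the graded module `M` is flat. -/
theorem IsLeftGrading.flatLeft (hℳ : IsLeftGrading 𝒜 ℳ)
    (hM : ∀ (N : Type (max u w)) [AddCommGroup N] [Module B N] (𝒩 : Γ → AddSubgroup N),
      IsRightGrading σ 𝒜 𝒩 → TorVanish σ N 0 M)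
    {ι : Type (max u w)} (deg : ι → Γ) (y : ι → M) (hy : ∀ i, y i ∈ ℳ (deg i))
    (hsurj : Function.Surjective (Finsupp.linearCombination A y)) :
    FlatLeft σ M := by
  let F : Type (max u w) := ι →₀ A
  let q : F →ₗ[A] M := Finsupp.linearCombination A y
  have hF : IsLeftGrading 𝒜 (h𝒜.free deg) := h𝒜.isLeftGrading_free deg
  have hqF : ∀ γ, ∀ x ∈ h𝒜.free deg γ, q x ∈ ℳ γ := fun γ x hx =>
    h𝒜.linearCombination_mem hℳ hy hx
  have hL := hℳ.ker hF q hqF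
  let E (φ : F →ₗ[A] F) : Prop :=
    (∀ γ, ∀ f ∈ h𝒜.free deg γ, φ f ∈ h𝒜.free deg γ) ∧ q ∘ₗ φ = q
  have hE {φ ψ : F →ₗ[A] F} (hφ : E φ) (hψ : E ψ) : E (ψ ∘ₗ φ) :=
    ⟨fun γ f hf => hψ.1 γ _ (hφ.1 γ f hf), by rw [← LinearMap.comp_assoc, hψ.2, hφ.2]⟩
  intro N N' _ _ _ _ f hf
  -- Quantifying over φ makes the induction additive: once ψ ∘ φ kills s, the statement for t is
  -- applied to ψ ∘ φ.
  have key (t : AntiTensor σ N' (LinearMap.ker q)) : ∀ φ, E φ → ∃ ψ, E ψ ∧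
      map σ .id (ψ ∘ₗ φ) (map σ .id (LinearMap.ker q).subtype t) = 0 := by
    have hadd (s t : AntiTensor σ N' (LinearMap.ker q))
        (hs : ∀ φ, E φ → ∃ ψ, E ψ ∧
          map σ .id (ψ ∘ₗ φ) (map σ .id (LinearMap.ker q).subtype s) = 0)
        (ht : ∀ φ, E φ → ∃ ψ, E ψ ∧
          map σ .id (ψ ∘ₗ φ) (map σ .id (LinearMap.ker q).subtype t) = 0) :
        ∀ φ, E φ → ∃ ψ, E ψ ∧
          map σ .id (ψ ∘ₗ φ) (map σ .id (LinearMap.ker q).subtype (s + t)) = 0 := by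
      intro φ hφ
      obtain ⟨ψ, hψ, h1⟩ := hs φ hφ
      obtain ⟨θ, hθ, h2⟩ := ht _ (hE hφ hψ)
      refine ⟨θ ∘ₗ ψ, hE hψ hθ, ?_⟩
      have h3 := map_map σ (.id : N' →ₗ[B] N') (ψ ∘ₗ φ) (.id : N' →ₗ[B] N') θ
        (map σ .id (LinearMap.ker q).subtype s)
      rw [h1, map_zero] at h3
      rw [map_add, map_add, LinearMap.comp_assoc, h2, add_zero]
      exact h3.symm
    have hzero : ∀ φ, E φ → ∃ ψ, E ψ ∧
        map σ .id (ψ ∘ₗ φ) (map σ .id (LinearMap.ker q).subtype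
          (0 : AntiTensor σ N' (LinearMap.ker q))) = 0 :=
      fun φ _ => ⟨.id, ⟨fun _ _ h => h, rfl⟩, by rw [map_zero, map_zero]⟩
    induction t using AntiTensor.induction_on with
    | zero => exact hzero
    | tmul n x =>
      induction x using hL.isGrading.induction_on with
      | mem γ x hx =>
        intro φ hφ
        have h0 : q (φ x) = 0 := (DFunLike.congr_fun hφ.2 x.1).trans x.2
        obtain ⟨ψ, h1, h2, h3⟩ := hℳ.exists_endomorphism σ h𝒜 hM deg y hy hsurj
          (hφ.1 γ x hx) h0
        refine ⟨ψ, ⟨h1, h2⟩, ?_⟩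
        rw [map_tmul, map_tmul]
        exact (congrArg (tmul σ n) h3).trans (tmul_zero σ n)
      | zero => rw [tmul_zero]; exact hzero
      | add x y hx hy => rw [tmul_add]; exact hadd _ _ hx hy
    | add s t hs ht => exact hadd s t hs ht
  refine (injective_iff_map_eq_zero _).2 fun x hx => ?_
  obtain ⟨x, rfl⟩ := map_surjective σ (f := (.id : N →ₗ[B] N)) (g := q)
    Function.surjective_id hsurj x
  rw [map_comm] at hx
  obtain ⟨t, ht⟩ := exact_right.{u, max u w, max u w} σ (F := LinearMap.ker q)
    (f := (LinearMap.ker q).subtype)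
    (exact_ker_subtype q) hsurj _ hx
  -- The image of x in N' ⊗ F comes from N' ⊗ ker q, so some ψ over M kills it. Flatness of F gives
  -- ψ x = 0 already in N ⊗ F, and q ∘ ψ = q finishes.
  obtain ⟨ψ, hψ, h⟩ := key t .id ⟨fun _ _ h => h, rfl⟩
  rw [LinearMap.comp_id, ht, ← map_comm] at h
  have h' := flatLeft_finsupp.{u, w} σ ι _ _ f hf (h.trans (map_zero _).symm)
  have h1 := map_map σ (.id : N →ₗ[B] N) ψ (.id : N →ₗ[B] N) q x
  rw [h', map_zero, hψ.2] at h1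
  exact h1.symm

/-- If `Tor_{n+1}(N, M)` vanishes for all graded `N`, then the graded module `M` has flat dimension
at most `n`. -/
theorem IsMulGrading.hasFlatResolution (n : ℕ) : ∀ (M : Type (max u w)) [AddCommGroup M]
    [Module A M] (ℳ : Γ → AddSubgroup M), IsLeftGrading 𝒜 ℳ →
    (∀ (N : Type (max u w)) [AddCommGroup N] [Module B N] (𝒩 : Γ → AddSubgroup N),
      IsRightGrading σ 𝒜 𝒩 → TorVanish σ N n M) →
    HasFlatResolution.{u, max u w} A (FlatLeft σ) M (n + 1) := by
  have hcover (M : Type (max u w)) [AddCommGroup M]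
      [Module A M] (ℳ : Γ → AddSubgroup M) (hℳ : IsLeftGrading 𝒜 ℳ) :
      Function.Surjective (Finsupp.linearCombination A
        (Subtype.val : {x : M // ∃ γ, x ∈ ℳ γ} → M)) := by
    intro x
    induction x using hℳ.isGrading.induction_on with
    | mem γ x hx => exact ⟨Finsupp.single ⟨x, γ, hx⟩ 1, by simp⟩
    | zero => exact ⟨0, map_zero _⟩
    | add x y hx hy =>
      obtain ⟨f, rfl⟩ := hx
      obtain ⟨g, rfl⟩ := hy
      exact ⟨f + g, map_add _ _ _⟩
  induction n with
  | zero =>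
    intro M _ _ ℳ hℳ hM
    exact HasFlatResolution.of_flat (fun F _ _ _ => FlatLeft.of_subsingleton σ F) M
      (hℳ.flatLeft σ h𝒜 hM (fun x => x.2.choose) Subtype.val (fun x => x.2.choose_spec)
        (hcover M ℳ hℳ))
  | succ n ih =>
    intro M _ _ ℳ hℳ hM
    refine HasFlatResolution.succ_of_ker _ (hcover M ℳ hℳ) (flatLeft_finsupp.{u, w} σ _) _
      (ih _ _ (hℳ.ker (h𝒜.isLeftGrading_free
        (fun x : {x : M // ∃ γ, x ∈ ℳ γ} => x.2.choose)) _ fun γ x hx =>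
          h𝒜.linearCombination_mem hℳ (fun x => x.2.choose_spec) hx) ?_)
    exact fun N _ _ 𝒩 h𝒩 => hM N 𝒩 h𝒩 _ _ (flatLeft_finsupp.{u, w} σ _) (hcover M ℳ hℳ)

theorem IsMulGrading.hasFlatResolution_of_right (n : ℕ)
    (h : ∀ (N : Type (max u w)) [AddCommGroup N] [Module B N] (𝒩 : Γ → AddSubgroup N),
      IsRightGrading σ 𝒜 𝒩 → HasFlatResolution.{u, max u w} B (FlatRight σ) N (n + 1))
    (M : Type (max u w)) [AddCommGroup M] [Module A M] (ℳ : Γ → AddSubgroup M)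
    (hℳ : IsLeftGrading 𝒜 ℳ) : HasFlatResolution.{u, max u w} A (FlatLeft σ) M (n + 1) :=
  h𝒜.hasFlatResolution σ n M ℳ hℳ fun N _ _ 𝒩 h𝒩 =>
    torVanish_of_hasFlatResolution σ n N (h N 𝒩 h𝒩) M

end GradedFlat

/-! ### Flat dimension and flatness for left and right modules -/

section Comparison

open AntiTensor

theorem sInf_le_natCast_iff {p : ℕ → Prop} (hp : Monotone p) (n : ℕ) :
    sInf {d : ℕ∞ | ∃ n : ℕ, d = (n : ℕ∞) ∧ p n} ≤ n ↔ p n := by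
  constructor
  · intro h
    have hne : {d : ℕ∞ | ∃ n : ℕ, d = (n : ℕ∞) ∧ p n}.Nonempty := by
      by_contra hemp
      rw [Set.not_nonempty_iff_eq_empty.1 hemp, sInf_empty, top_le_iff] at h
      exact ENat.natCast_ne_top n h
    obtain ⟨m, hm, hpm⟩ := csInf_mem hne
    rw [hm, Nat.cast_le] at h
    exact hp h hpm
  · exact fun h => sInf_le ⟨n, rfl, h⟩

theorem HasFlatResolution.congr {S : Type u} [Ring S]
    {flat flat' : ∀ (F : Type (max u v)) [AddCommGroup F] [Module S F], Prop}
    (h : ∀ (F : Type (max u v)) [AddCommGroup F] [Module S F], flat F ↔ flat' F)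
    {M : Type v} [AddCommGroup M] [Module S M] {n : ℕ} (hM : HasFlatResolution S flat M n) :
    HasFlatResolution S flat' M n := by
  obtain ⟨P, hP, hs⟩ := hM
  exact ⟨P, fun i => (h _).1 (hP i), hs⟩

variable (R : Type u) [Ring R]

theorem leftFlatDim_le_iff (M : Type (max u w)) [AddCommGroup M] [Module R M] (n : ℕ) :
    leftFlatDim R M ≤ n ↔
      HasFlatResolution.{u, max u w} R (fun F => IsFlatLeft.{u, max u w} R F) M (n + 1) :=
  sInf_le_natCast_iff (fun _ _ hmn ⟨P, hP, hs⟩ => ⟨P, hP, fun i hi => hs i (hmn.trans_lt hi)⟩) n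

theorem rightFlatDim_le_iff (M : Type (max u w)) [AddCommGroup M] [Module Rᵐᵒᵖ M] (n : ℕ) :
    rightFlatDim R M ≤ n ↔
      HasFlatResolution.{u, max u w} Rᵐᵒᵖ (fun F => IsFlatRight.{u, max u w} R F) M (n + 1) :=
  sInf_le_natCast_iff (fun _ _ hmn ⟨P, hP, hs⟩ => ⟨P, hP, fun i hi => hs i (hmn.trans_lt hi)⟩) n

theorem balancedTensor_map_eq {N N' : Type v} [AddCommGroup N] [Module Rᵐᵒᵖ N]
    [AddCommGroup N'] [Module Rᵐᵒᵖ N']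
    {F F' : Type w} [AddCommGroup F] [Module R F] [AddCommGroup F'] [Module R F']
    (f : N →ₗ[Rᵐᵒᵖ] N') (g : F →ₗ[R] F') :
    BalancedTensor.map R f g = AntiTensor.map (RingEquiv.opOp R) f g :=
  AntiTensor.hom_ext (σ := RingEquiv.opOp R) fun _ _ => rfl

theorem flatLeft_opOp_iff (F : Type (max u w)) [AddCommGroup F] [Module R F] :
    FlatLeft (RingEquiv.opOp R) F ↔ IsFlatLeft.{u, max u w} R F := by
  constructor <;> intro h N N' _ _ _ _ f hf
  · rw [balancedTensor_map_eq]
    exact h N N' f hf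
  · rw [← balancedTensor_map_eq]
    exact h N N' f hf

theorem flatRight_opOp_iff (F : Type (max u w)) [AddCommGroup F] [Module Rᵐᵒᵖ F] :
    FlatRight (RingEquiv.opOp R) F ↔ IsFlatRight.{u, max u w} R F := by
  constructor <;> intro h N N' _ _ _ _ f hf
  · rw [balancedTensor_map_eq]
    exact h N N' f hf
  · rw [← balancedTensor_map_eq]
    exact h N N' f hf

namespace AntiTensor

/-- Exchanging the two factors of a tensor product. -/
def swap (N : Type v₁) [AddCommGroup N] [Module Rᵐᵒᵖ N] (F : Type v₂) [AddCommGroup F]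
    [Module R F] :
    AntiTensor (RingEquiv.opOp R) N F ≃+ AntiTensor (RingEquiv.refl Rᵐᵒᵖ) F N where
  toFun := lift _ (tmulHom (RingEquiv.refl Rᵐᵒᵖ)).flip fun n a x =>
    (smul_tmul (RingEquiv.refl Rᵐᵒᵖ) x (.op a) n).symm
  invFun := lift _ (tmulHom (RingEquiv.opOp R)).flip fun x a n =>
    (smul_tmul (RingEquiv.opOp R) n a.unop x).symm
  left_inv t := by
    induction t using induction_on with
    | zero => simp
    | tmul n x => rfl
    | add s t hs ht => rw [map_add, map_add, hs, ht]
  right_inv t := by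
    induction t using induction_on with
    | zero => simp
    | tmul n x => rfl
    | add s t hs ht => rw [map_add, map_add, hs, ht]
  map_add' := map_add _

theorem swap_map {N N' : Type v₁} [AddCommGroup N] [Module Rᵐᵒᵖ N]
    [AddCommGroup N'] [Module Rᵐᵒᵖ N']
    {F F' : Type v₂} [AddCommGroup F] [Module R F] [AddCommGroup F'] [Module R F']
    (f : N →ₗ[Rᵐᵒᵖ] N') (g : F →ₗ[R] F') (t : AntiTensor (RingEquiv.opOp R) N F) :
    swap R N' F' (map _ f g t) = map _ g f (swap R N F t) := by
  induction t using induction_on with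
  | zero => simp
  | tmul n x => rfl
  | add s t hs ht => simp only [map_add, hs, ht]

theorem injective_map_refl_iff {N N' : Type v₁} [AddCommGroup N] [Module Rᵐᵒᵖ N]
    [AddCommGroup N'] [Module Rᵐᵒᵖ N']
    {F F' : Type v₂} [AddCommGroup F] [Module R F] [AddCommGroup F'] [Module R F']
    (f : N →ₗ[Rᵐᵒᵖ] N') (g : F →ₗ[R] F') :
    Function.Injective (map (RingEquiv.refl Rᵐᵒᵖ) g f) ↔
      Function.Injective (map (RingEquiv.opOp R) f g) := by
  rw [← (swap R N F).injective_comp, ← (swap R N' F').comp_injective]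
  exact iff_of_eq (congrArg _ (funext fun t => (swap_map R f g t).symm))

end AntiTensor

theorem flatLeft_refl_iff (F : Type (max u w)) [AddCommGroup F] [Module Rᵐᵒᵖ F] :
    FlatLeft (RingEquiv.refl Rᵐᵒᵖ) F ↔ IsFlatRight.{u, max u w} R F := by
  rw [← flatRight_opOp_iff]
  constructor <;> intro h N N' _ _ _ _ f hf
  · exact (injective_map_refl_iff R _ _).1 (h N N' f hf)
  · exact (injective_map_refl_iff R _ _).2 (h N N' f hf)

theorem flatRight_refl_iff (F : Type (max u w)) [AddCommGroup F] [Module R F] :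
    FlatRight (RingEquiv.refl Rᵐᵒᵖ) F ↔ IsFlatLeft.{u, max u w} R F := by
  rw [← flatLeft_opOp_iff]
  constructor <;> intro h N N' _ _ _ _ f hf
  · exact (injective_map_refl_iff R _ _).1 (h N N' f hf)
  · exact (injective_map_refl_iff R _ _).2 (h N N' f hf)

end Comparison

/-! ### The two inequalities -/

section Main

open AntiTensor

variable {Γ : Type v} [DecidableEq Γ] [AddCancelMonoid Γ] {R : Type u} [Ring R]
  (𝒜 : Γ → AddSubgroup R) [GradedRing 𝒜]

theorem leftFlatDim_le_of_rightFlatDim_le (n : ℕ)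
    (h : ∀ (N : Type (max u w)) [AddCommGroup N] [Module Rᵐᵒᵖ N] (𝒩 : Γ → AddSubgroup N),
      IsGradedRightModule 𝒜 𝒩 → rightFlatDim R N ≤ n)
    (M : Type (max u w)) [AddCommGroup M] [Module R M] (ℳ : Γ → AddSubgroup M)
    (hℳ : IsGradedLeftModule 𝒜 ℳ) : leftFlatDim R M ≤ n := by
  let _ : Semigroup Γ := { mul := fun α β => α + β, mul_assoc := add_assoc }
  have : IsCancelMul Γ :=
    { mul_left_cancel := fun α _ _ h => add_left_cancel (a := α) h
      mul_right_cancel := fun α _ _ h => add_right_cancel (b := α) h }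
  have h𝒜 : IsMulGrading 𝒜 :=
    { isGrading := IsGrading.isInternal_iff.1 (DirectSum.Decomposition.isInternal 𝒜)
      mul_mem := fun _ _ _ _ ha hb => SetLike.mul_mem_graded ha hb }
  have key := h𝒜.hasFlatResolution_of_right.{u, v, w} (RingEquiv.opOp R) n
    (fun N _ _ 𝒩 h𝒩 => by
      exact HasFlatResolution.congr (fun F _ _ => (flatRight_opOp_iff.{u, w} R F).symm)
        ((rightFlatDim_le_iff.{u, w} R N n).1 (h N 𝒩
        { isInternal := IsGrading.isInternal_iff.2 h𝒩.isGrading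
          smul_mem := h𝒩.smul_mem })))
    M ℳ
    { isGrading := IsGrading.isInternal_iff.1 hℳ.isInternal
      smul_mem := hℳ.smul_mem }
  rw [leftFlatDim_le_iff.{u, w}]
  exact key.congr fun F _ _ => flatLeft_opOp_iff.{u, w} R F

theorem rightFlatDim_le_of_leftFlatDim_le (n : ℕ)
    (h : ∀ (N : Type (max u w)) [AddCommGroup N] [Module R N] (𝒩 : Γ → AddSubgroup N),
      IsGradedLeftModule 𝒜 𝒩 → leftFlatDim R N ≤ n)
    (M : Type (max u w)) [AddCommGroup M] [Module Rᵐᵒᵖ M] (ℳ : Γ → AddSubgroup M)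
    (hℳ : IsGradedRightModule 𝒜 ℳ) : rightFlatDim R M ≤ n := by
  -- The opposite monoid: in Rᵐᵒᵖ the product of the pieces of degrees α and β lies in degree β + α.
  let _ : Semigroup Γ :=
    { mul := fun α β => β + α, mul_assoc := fun α β γ => (add_assoc γ β α).symm }
  have : IsCancelMul Γ :=
    { mul_left_cancel := fun α _ _ h => add_right_cancel (b := α) h
      mul_right_cancel := fun α _ _ h => add_left_cancel (a := α) h }
  let 𝒜' : Γ → AddSubgroup Rᵐᵒᵖ := fun γ =>
    (𝒜 γ).comap MulOpposite.opAddEquiv.symm.toAddMonoidHom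
  have h𝒜 : IsGrading 𝒜 :=
    IsGrading.isInternal_iff.1 (DirectSum.Decomposition.isInternal 𝒜)
  have h𝒜' : IsMulGrading 𝒜' :=
    { isGrading := h𝒜.comap_of_proj_mem _ MulOpposite.unop_injective
        fun γ y => ⟨.op (h𝒜.proj γ y.unop), rfl⟩
      mul_mem := fun _ _ a b ha hb =>
        SetLike.mul_mem_graded (A := 𝒜) (gi := b.unop) (gj := a.unop) hb ha }
  have key := h𝒜'.hasFlatResolution_of_right.{u, v, w} (RingEquiv.refl Rᵐᵒᵖ) n
    (fun N _ _ 𝒩 h𝒩 => by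
      exact HasFlatResolution.congr (fun F _ _ => (flatRight_refl_iff.{u, w} R F).symm)
        ((leftFlatDim_le_iff.{u, w} R N n).1 (h N 𝒩
        { isInternal := IsGrading.isInternal_iff.2 h𝒩.isGrading
          smul_mem := fun α β a x ha hx => h𝒩.smul_mem β α x (.op a) hx ha })))
    M ℳ
    { isGrading := IsGrading.isInternal_iff.1 hℳ.isInternal
      smul_mem := fun α β a x ha hx => hℳ.smul_mem β α x a.unop hx ha }
  rw [rightFlatDim_le_iff.{u, w}]
  exact key.congr fun F _ _ => flatLeft_refl_iff.{u, w} R F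

end Main

theorem proposition2p6 {Γ : Type v} [DecidableEq Γ] [AddCancelMonoid Γ] {R : Type u} [Ring R]
    (𝒜 : Γ → AddSubgroup R) [GradedRing 𝒜] :
    grLeftWeakDim.{u, v, w} 𝒜 = grRightWeakDim.{u, v, w} 𝒜 := by
  -- Both suprema have the same upper bounds; only finite bounds need an argument.
  refine eq_of_forall_ge_iff fun d => ?_
  induction d using ENat.recTopCoe with
  | top => simp
  | coe n =>
    constructor
    · intro h
      refine sSup_le ?_
      rintro _ ⟨M, _, _, ℳ, hℳ, rfl⟩
      exact rightFlatDim_le_of_leftFlatDim_le.{u, v, w} 𝒜 n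
        (fun N _ _ 𝒩 h𝒩 => sSup_le_iff.1 h _ ⟨N, ‹_›, ‹_›, 𝒩, h𝒩, rfl⟩) M ℳ hℳ
    · intro h
      refine sSup_le ?_
      rintro _ ⟨M, _, _, ℳ, hℳ, rfl⟩
      exact leftFlatDim_le_of_rightFlatDim_le.{u, v, w} 𝒜 n
        (fun N _ _ 𝒩 h𝒩 => sSup_le_iff.1 h _ ⟨N, ‹_›, ‹_›, 𝒩, h𝒩, rfl⟩) M ℳ hℳ
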